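/- Call a probability density $f>0$ on $\mathbb R^d$ strictly log-concave if its potential $-\log f$ is $C^2$ and there are constants $0<m\le M<\infty$ with $m|v|^2\le \langle v,\,(-\log f)''(x)\,v\rangle\le M|v|^2$ for all $x,v\in\mathbb R^d$. Let the target density $\pi=e^{-U}$ and the auxiliary density $\mathfrak g=e^{-V}$ on $\mathbb R^d$ be strictly log-concave. Let $(Q(t),P(t))$, $t\in\mathbb R$, be the exact solution of $$\dot Q=\nabla V(P),\qquad \dot P=-\nabla U(Q),\qquad (Q(0),P(0))=(q,p).$$ For $t>0$ put $\bar V(t)=\frac1t\int_0^tV''(P(s))\,ds$, $\bar U(t)=\frac1t\int_0^tU''(Q(s))\,ds$ and $$A(t)=\sqrt{\bar V\bar U}:=\sqrt{\bar U}^{\,-1}\sqrt{\sqrt{\bar U}\,\bar V\sqrt{\bar U}}\;\sqrt{\bar U},$$ where the roots of symmetric positive matrices are the symmetric positive ones. Let $|A|$ be the supremum of the operator norm of $A(t)$ over all $0<t\le T$ and all starting points $(q,p)$, and let $0<T<\pi/|A|$ (here $\pi=3.14\ldots$; $\pi/0=\infty$). One iteration of AD-HMC from a position $q$ draws $p\sim\mathfrak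 g$ and moves to $q'=Q(T)$ along the motion started at $(q,p)$; then it draws an independent $p'\sim\mathfrak g$ and moves to $Q(-T)$ along the motion started at $(q',p')$. Let $\mu_n$ be the law of the position after $n$ iterations started from the law $\mu_0$. Then AD-HMC converges geometrically to the target in $W_1$: there are constants $\rho\in(0,1)$ and $C>0$, independent of $\mu_0$ and $n$, such that for every probability measure $\mu_0$ on $\mathbb R^d$ with finite first moment and every $n\ge0$, $$W_1(\mu_n,\ \pi(q)\,dq)\ \le\ C\,\rho^{\,n}\Bigl(1+\int|q|\,\mu_0(dq)\Bigr).$$ -/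

import Mathlib

open MeasureTheory

noncomputable section

namespace ADHMC

/-- The position space and the momentum space: `ℝ^d` with its Euclidean norm. -/
abbrev E (d : ℕ) : Type := EuclideanSpace ℝ (Fin d)

/-- The potential `-log f` of a positive density `f`, so that `f = exp (-potential f)`. -/
def potential {d : ℕ} (f : E d → ℝ) : E d → ℝ := fun x => -Real.log (f x)

/-- The Hessian of `u` at `x`, as an operator on `ℝ^d`. -/
def hess {d : ℕ} (u : E d → ℝ) (x : E d) : E d →L[ℝ] E d :=
  fderiv ℝ (fun y => gradient u y) x

/-- `f` is a strictly log-concave probability density on `ℝ^d`: it is everywhere positive and of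
total mass one, its potential is `C²`, and the spectrum of the Hessian of the potential is bounded
away from `0` and from `∞`, uniformly on the whole space. -/
structure IsStrictlyLogConcaveDensity {d : ℕ} (f : E d → ℝ) : Prop where
  pos : ∀ x, 0 < f x
  integral_eq_one : ∫ x, f x = 1
  contDiff : ContDiff ℝ 2 (potential f)
  hess_bounds : ∃ m M : ℝ, 0 < m ∧ ∀ x v : E d,
    m * ‖v‖ ^ 2 ≤ inner ℝ v (hess (potential f) x v) ∧
      inner ℝ v (hess (potential f) x v) ≤ M * ‖v‖ ^ 2

/-- The probability measure with density `f` with respect to Lebesgue measure. -/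
def densityMeasure {d : ℕ} (f : E d → ℝ) : Measure (E d) :=
  volume.withDensity fun x => ENNReal.ofReal (f x)

/-- `Φ t (q, p) = (Q t, P t)` is the exact solution, for all times `t ∈ ℝ`, of the Hamiltonian
system `Q' = ∂H/∂p`, `P' = -∂H/∂q`, `(Q 0, P 0) = (q, p)` with `H (q, p) = U q + V p`. -/
def IsHamiltonianFlow {d : ℕ} (U V : E d → ℝ) (Φ : ℝ → E d × E d → E d × E d) : Prop :=
  ∀ z : E d × E d, Φ 0 z = z ∧
    ∀ t : ℝ, HasDerivAt (fun s => Φ s z) (gradient V (Φ t z).2, -gradient U (Φ t z).1) t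

/-- The average `V̄ t = (1 / t) ∫_0^t V'' (P s) ds` along the trajectory started at `z = (q, p)`. -/
def avgV {d : ℕ} (V : E d → ℝ) (Φ : ℝ → E d × E d → E d × E d) (t : ℝ) (z : E d × E d) :
    E d →L[ℝ] E d :=
  t⁻¹ • ∫ s in (0 : ℝ)..t, hess V (Φ s z).2

/-- The average `Ū t = (1 / t) ∫_0^t U'' (Q s) ds` along the trajectory started at `z = (q, p)`. -/
def avgU {d : ℕ} (U : E d → ℝ) (Φ : ℝ → E d × E d → E d × E d) (t : ℝ) (z : E d × E d) :
    E d →L[ℝ] E d :=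
  t⁻¹ • ∫ s in (0 : ℝ)..t, hess U (Φ s z).1

open Classical in
/-- The symmetric positive square root of a symmetric positive operator
(and `0` for an operator that has no such root). -/
def posSqrt {d : ℕ} (S : E d →L[ℝ] E d) : E d →L[ℝ] E d :=
  if h : ∃ R : E d →L[ℝ] E d, R.IsPositive ∧ R ∘L R = S then h.choose else 0

theorem posSqrt_spec {d : ℕ} {S : E d →L[ℝ] E d} (hS : S.IsPositive) :
    (posSqrt S).IsPositive ∧ posSqrt S ∘L posSqrt S = S := by
  have h : ∃ R : E d →L[ℝ] E d, R.IsPositive ∧ R ∘L R = S := by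
    have hL : S.toLinearMap.IsPositive := (ContinuousLinearMap.isPositive_toLinearMap_iff S).2 hS
    have hsym := hL.isSymmetric
    set n := Module.finrank ℝ (E d) with hn
    let b := hsym.eigenvectorBasis hn.symm
    let l := hsym.eigenvalues hn.symm
    have hl : ∀ i, 0 ≤ l i := fun i => hL.nonneg_eigenvalues hn.symm i
    let R : E d →L[ℝ] E d :=
      ∑ i, Real.sqrt (l i) • ((innerSL ℝ (b i)).smulRight (b i))
    have hR : ∀ x, R x = ∑ i, (Real.sqrt (l i) * inner ℝ (b i) x) • b i := by
      intro x
      simp [R, smul_smul]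
    have hRb : ∀ j, R (b j) = Real.sqrt (l j) • b j := by
      intro j
      rw [hR, Finset.sum_eq_single j]
      · simp
      · intro i _ hij
        simp [b.inner_eq_zero hij]
      · simp
    refine ⟨R, ?_, ?_⟩
    · rw [ContinuousLinearMap.isPositive_iff]
      refine ⟨?_, ?_⟩
      · intro x y
        change inner ℝ (R x) y = inner ℝ x (R y)
        rw [hR, hR, sum_inner, inner_sum]
        refine Finset.sum_congr rfl fun i _ => ?_
        rw [real_inner_smul_left, real_inner_smul_right, real_inner_comm (b i) x]
        ring
      · intro x
        rw [hR, sum_inner]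
        refine Finset.sum_nonneg fun i _ => ?_
        rw [real_inner_smul_left, mul_assoc]
        exact mul_nonneg (Real.sqrt_nonneg _) (mul_self_nonneg _)
    · have : (R ∘L R).toLinearMap = S.toLinearMap := by
        refine b.toBasis.ext fun j => ?_
        have h2 : S (b j) = l j • b j := hsym.apply_eigenvectorBasis hn.symm j
        simp only [OrthonormalBasis.coe_toBasis, ContinuousLinearMap.coe_coe,
          ContinuousLinearMap.comp_apply]
        rw [hRb, map_smul, hRb, smul_smul, Real.mul_self_sqrt (hl j), h2]
      exact ContinuousLinearMap.coe_injective this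
  rw [posSqrt, dif_pos h]
  exact h.choose_spec

theorem posSqrt_unique {d : ℕ} {R : E d →L[ℝ] E d} (hR : R.IsPositive) :
    posSqrt (R ∘L R) = R := by
  have hS : (R ∘L R).IsPositive := by
    rw [ContinuousLinearMap.isPositive_iff]
    refine ⟨fun x y => ?_, fun x => ?_⟩
    · exact (hR.isSymmetric _ _).trans (hR.isSymmetric _ _)
    · have h : inner ℝ (R (R x)) x = inner ℝ (R x) (R x) := hR.isSymmetric _ _
      change 0 ≤ inner ℝ (R (R x)) x
      rw [h]
      exact real_inner_self_nonneg
  obtain ⟨hP, hPP⟩ := posSqrt_spec hS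
  set P := posSqrt (R ∘L R)
  have hL : R.toLinearMap.IsPositive := (ContinuousLinearMap.isPositive_toLinearMap_iff R).2 hR
  have hsym := hL.isSymmetric
  set n := Module.finrank ℝ (E d) with hn
  let b := hsym.eigenvectorBasis hn.symm
  have : P.toLinearMap = R.toLinearMap := by
    refine b.toBasis.ext fun j => ?_
    set c := hsym.eigenvalues hn.symm j with hc
    have hc0 : 0 ≤ c := hL.nonneg_eigenvalues hn.symm j
    have h2 : R (b j) = c • b j := hsym.apply_eigenvectorBasis hn.symm j
    have h3 : P (P (b j)) = (c * c) • b j := by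
      have := congrArg (fun F : E d →L[ℝ] E d => F (b j)) hPP
      simpa [h2, smul_smul] using this
    have hw : P (P (b j) - c • b j) = -c • (P (b j) - c • b j) := by
      rw [map_sub, map_smul, h3]
      module
    have hz : P (b j) - c • b j = 0 := by
      rcases hc0.eq_or_lt with h0 | h0
      · have h4 : inner ℝ (P (P (b j))) (b j) = inner ℝ (P (b j)) (P (b j)) :=
          hP.isSymmetric _ _
        rw [h3, ← h0] at h4
        simp only [mul_zero, zero_smul, inner_zero_left] at h4
        rw [← h0, zero_smul, sub_zero]
        exact inner_self_eq_zero.1 h4.symm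
      · have h5 : 0 ≤ inner ℝ (P (P (b j) - c • b j)) (P (b j) - c • b j) :=
          ((ContinuousLinearMap.isPositive_iff P).1 hP).2 _
        rw [hw, real_inner_smul_left] at h5
        have h6 : 0 ≤ inner ℝ (P (b j) - c • b j) (P (b j) - c • b j) :=
          real_inner_self_nonneg
        exact inner_self_eq_zero.1 (le_antisymm (by nlinarith) h6)
    simp only [OrthonormalBasis.coe_toBasis, ContinuousLinearMap.coe_coe]
    rw [h2, sub_eq_zero.1 hz]
  exact ContinuousLinearMap.coe_injective this

/-- The positive square root `√(V U) = √U⁻¹ √(√U V √U) √U` of the product of two symmetric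
positive definite operators. -/
def sqrtMul {d : ℕ} (V U : E d →L[ℝ] E d) : E d →L[ℝ] E d :=
  (posSqrt U).inverse ∘L posSqrt (posSqrt U ∘L V ∘L posSqrt U) ∘L posSqrt U

/-- The operator `A = √(V̄ Ū)` at time `t` along the trajectory started at `z = (q, p)`. -/
def opA {d : ℕ} (U V : E d → ℝ) (Φ : ℝ → E d × E d → E d × E d) (t : ℝ) (z : E d × E d) :
    E d →L[ℝ] E d :=
  sqrtMul (avgV V Φ t z) (avgU U Φ t z)

/-- The uniform bound `|A|`: the supremum of the operator norm of `A = √(V̄ Ū)` over all starting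
points `(q, p)` and all times in `(0, T]`. -/
def normA {d : ℕ} (U V : E d → ℝ) (Φ : ℝ → E d × E d → E d × E d) (T : ℝ) : ENNReal :=
  ⨆ z : E d × E d, ⨆ t ∈ Set.Ioc (0 : ℝ) T, ‖opA U V Φ t z‖ₑ

/-- One Hamiltonian move of length `t`, acting on the law `μ` of the position: draw an independent
momentum with law `G`, apply the motion for time `t`, keep the position. -/
def hmcStep {d : ℕ} (Φ : ℝ → E d × E d → E d × E d) (G : Measure (E d)) (t : ℝ)
    (μ : Measure (E d)) : Measure (E d) :=
  (μ.prod G).map fun z => (Φ t z).1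

/-- One iteration of AD-HMC: a forward move of length `T`, then, with a fresh momentum, a backward
move of length `-T`. -/
def adhmcStep {d : ℕ} (Φ : ℝ → E d × E d → E d × E d) (G : Measure (E d)) (T : ℝ)
    (μ : Measure (E d)) : Measure (E d) :=
  hmcStep Φ G (-T) (hmcStep Φ G T μ)

/-- The Wasserstein distance `W₁`: the infimum over all couplings of the mean distance. -/
def W1 {d : ℕ} (μ ν : Measure (E d)) : ENNReal :=
  ⨅ γ : Measure (E d × E d), ⨅ _ : γ.map Prod.fst = μ ∧ γ.map Prod.snd = ν,
    ∫⁻ z, edist z.1 z.2 ∂γ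

end ADHMC

end

noncomputable section

namespace ADHMC

/-! ### Sturm comparison for differences of trajectories. -/

section Core

open Set Filter Topology

variable {F : Type*} [NormedAddCommGroup F] [InnerProductSpace ℝ F]

/-! The heart is a Sturm comparison: two motions leaving one position with different momenta cannot
meet again before time π/|A|. As t ↓ 0 the averaged Hessians tend to the Hessians at the starting
point, which is arbitrary. Hence, for some `a` with |A| < `a` < π/T, the norm of V''(p) U''(q) is at
most `a ^ 2` for every p and q (`norm_hess_comp_hess_le`).

Let x and y be the differences of positions and of momenta, with x(0) = 0, and let N(v)² be the
supremum over q of ⟨v, U''(q) v⟩, a norm that does not change in time. Then N(x')² ≤ a²⟨x', y⟩ and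
-⟨x, y'⟩ ≤ N(x)². If φ is a shifted cotangent solving φ' = -(1 + a²φ²), the quantity ⟨x, y⟩ - φ
N(x)² is nondecreasing (`energy_sub_cot_mono`). Shortly after the start it is at least a multiple of
|y(0)|², so |x(t)| ≥ c|y(0)| up to time T (`exists_le_norm_of_isVariation`). Exchanging U and V, the
final momentum controls the initial position in the same way.

This has two consequences. The map p ↦ Q(T) is Lipschitz and expanding, and by continuation in time
it is onto; so from any bounded set of positions the law of Q(T) has a uniform lower bound on a
fixed ball (`exists_minorization`). And a motion started far from the minimiser of U ends with a
large momentum unless its initial momentum was large, so by conservation of energy the forward move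
contracts √(U - min U) up to the size of the momentum (`exists_lyapunov_contraction`); the backward
move only adds such a term.

These are the hypotheses of Harris' theorem (`exists_iterate_split`). The target is invariant by
conservation of energy and Liouville's theorem, the latter obtained as a limit of volume-preserving
Euler steps. Finally √(U - min U) is comparable to |q|, so the weighted mass of the parts not yet
coupled dominates W₁ (`W1_le_of_split`). -/

theorem abs_deriv_seminorm_comp_le {N : Seminorm ℝ F} (hN : Continuous N) {x : ℝ → F} {x' : F}
    {r' s : ℝ} (hx : HasDerivAt x x' s) (hr : HasDerivAt (fun u => N (x u)) r' s) :
    |r'| ≤ N x' := by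
  have h1 := (hasDerivAt_iff_tendsto_slope.1 hr).abs
  have h2 := (hN.tendsto x').comp (hasDerivAt_iff_tendsto_slope.1 hx)
  -- The inequality already holds for difference quotients, by the triangle inequality for `N`.
  refine le_of_tendsto_of_tendsto' h1 h2 fun z => ?_
  simp only [Function.comp, slope, vsub_eq_sub, smul_eq_mul, abs_mul, map_smul_eq_mul,
    Real.norm_eq_abs]
  exact mul_le_mul_of_nonneg_left (abs_sub_map_le_sub N (x z) (x s)) (abs_nonneg _)

theorem lipschitzOnWith_of_hasDerivAt_of_continuous {x x' : ℝ → F}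
    (hx : ∀ s, HasDerivAt x (x' s) s) (hx' : Continuous x') (a b : ℝ) :
    ∃ K : NNReal, LipschitzOnWith K x (Icc a b) := by
  obtain ⟨K, hK⟩ := (isCompact_Icc (a := a) (b := b)).exists_bound_of_continuousOn
    hx'.continuousOn
  refine ⟨K.toNNReal, (convex_Icc a b).lipschitzOnWith_of_nnnorm_hasDerivWithin_le
    (fun s _ => (hx s).hasDerivWithinAt) fun s hs => ?_⟩
  rw [← NNReal.coe_le_coe, coe_nnnorm]
  exact (hK s hs).trans (Real.le_coe_toNNReal K)

/-- This Riccati equation is what turns the derivative of the corrected energy form into a perfect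
square. -/
theorem hasDerivAt_cot_div {a δ s : ℝ} (ha : a ≠ 0) (hs : Real.sin (a * s + δ) ≠ 0) :
    HasDerivAt (fun u => Real.cos (a * u + δ) / (a * Real.sin (a * u + δ)))
      (-(1 + a ^ 2 * (Real.cos (a * s + δ) / (a * Real.sin (a * s + δ))) ^ 2)) s := by
  have h0 : HasDerivAt (fun u => a * u + δ) a s := by
    simpa using ((hasDerivAt_id s).const_mul a).add_const δ
  have := (h0.cos).div ((h0.sin).const_mul a) (mul_ne_zero ha hs)
  convert! this using 1
  field_simp
  ring

/-- Along a Hamiltonian variation, the energy form corrected by a shifted cotangent times the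
squared seminorm is monotone. -/
theorem energy_sub_cot_mono {N : Seminorm ℝ F} (hN : Continuous N) {B : NNReal}
    (hNB : LipschitzWith B N) {x y x' y' : ℝ → F}
    (hx : ∀ s, HasDerivAt x (x' s) s) (hy : ∀ s, HasDerivAt y (y' s) s)
    (hx' : Continuous x') (hy' : Continuous y') {a δ s₀ t : ℝ} (ha : 0 < a) (hδ : 0 < δ)
    (hs₀ : 0 ≤ s₀) (hst : s₀ ≤ t) (ht : a * t + δ < Real.pi)
    (h1 : ∀ s, N (x' s) ^ 2 ≤ a ^ 2 * inner ℝ (x' s) (y s))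
    (h2 : ∀ s, -inner ℝ (x s) (y' s) ≤ N (x s) ^ 2) :
    inner ℝ (x s₀) (y s₀) -
        Real.cos (a * s₀ + δ) / (a * Real.sin (a * s₀ + δ)) * N (x s₀) ^ 2 ≤
      inner ℝ (x t) (y t) - Real.cos (a * t + δ) / (a * Real.sin (a * t + δ)) * N (x t) ^ 2 := by
  have hsin : ∀ s ∈ Icc s₀ t, Real.sin (a * s + δ) ≠ 0 := fun s hs =>
    (Real.sin_pos_of_pos_of_lt_pi
      (by have := mul_nonneg ha.le (hs₀.trans hs.1); linarith)
      (by have := mul_le_mul_of_nonneg_left hs.2 ha.le; linarith)).ne'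
  set φ : ℝ → ℝ := fun s => Real.cos (a * s + δ) / (a * Real.sin (a * s + δ)) with hφ
  have hI : ∀ s, HasDerivAt (fun u => inner ℝ (x u) (y u))
      (inner ℝ (x s) (y' s) + inner ℝ (x' s) (y s)) s := fun s => (hx s).inner ℝ (hy s)
  have hxc : Continuous x := continuous_iff_continuousAt.2 fun s => (hx s).continuousAt
  have hyc : Continuous y := continuous_iff_continuousAt.2 fun s => (hy s).continuousAt
  -- `N ∘ x` is only Lipschitz, hence differentiable almost everywhere; absolute continuity allows
  -- the sign of the derivative to be integrated.
  have acI : AbsolutelyContinuousOnInterval (fun u => inner ℝ (x u) (y u)) s₀ t := by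
    obtain ⟨K, hK⟩ := lipschitzOnWith_of_hasDerivAt_of_continuous hI
      ((hxc.inner hy').add (hx'.inner hyc)) s₀ t
    exact LipschitzOnWith.absolutelyContinuousOnInterval (by rwa [uIcc_of_le hst])
  have acr : AbsolutelyContinuousOnInterval (fun u => N (x u)) s₀ t := by
    obtain ⟨K, hK⟩ := lipschitzOnWith_of_hasDerivAt_of_continuous hx hx' s₀ t
    refine LipschitzOnWith.absolutelyContinuousOnInterval (K := B * K) ?_
    rw [uIcc_of_le hst]
    exact hNB.comp_lipschitzOnWith hK
  have acφ : AbsolutelyContinuousOnInterval φ s₀ t := by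
    refine ContDiffOn.absolutelyContinuousOnInterval ?_
    rw [uIcc_of_le hst]
    refine ContDiffOn.div ?_ ?_ fun s hs => mul_ne_zero ha.ne' (hsin s hs)
    · exact ContDiff.contDiffOn (by fun_prop)
    · exact ContDiff.contDiffOn (by fun_prop)
  have acE := acI.sub (acφ.mul (acr.mul acr))
  have key := acE.integral_deriv_eq_sub
  have hpos : 0 ≤ ∫ u in s₀..t, deriv ((fun u => inner ℝ (x u) (y u)) -
      φ * ((fun u => N (x u)) * fun u => N (x u))) u := by
    refine intervalIntegral.integral_nonneg_of_ae_restrict hst ?_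
    refine (ae_restrict_iff' measurableSet_Icc).2 ?_
    filter_upwards [acr.ae_differentiableAt] with s hs hmem
    have hr := (hs (by rwa [uIcc_of_le hst])).hasDerivAt
    set r' := deriv (fun u => N (x u)) s
    have hb := abs_deriv_seminorm_comp_le hN (hx s) hr
    have hd := (hI s).sub ((hasDerivAt_cot_div ha.ne' (hsin s hmem)).mul (hr.mul hr))
    rw [Pi.zero_apply]
    have e : deriv ((fun u => inner ℝ (x u) (y u)) -
      φ * ((fun u => N (x u)) * fun u => N (x u))) s = _ := hd.deriv
    rw [e]
    have hφs : Real.cos (a * s + δ) / (a * Real.sin (a * s + δ)) = φ s := rfl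
    simp only [Pi.mul_apply, hφs]
    have g1 := h1 s
    have g2 := h2 s
    have g3 : φ s * (r' * N (x s)) ≤ |φ s| * (N (x' s) * N (x s)) := by
      refine (le_abs_self _).trans ?_
      rw [abs_mul, abs_mul, abs_of_nonneg (apply_nonneg N (x s))]
      gcongr
    have g4 : N (x' s) ^ 2 / a ^ 2 ≤ inner ℝ (x' s) (y s) := by
      rw [div_le_iff₀ (by positivity)]; linarith
    -- By the two hypotheses and the Riccati equation the derivative is bounded below by this
    -- square.
    have g5 : 0 ≤ (N (x' s) / a - a * |φ s| * N (x s)) ^ 2 := sq_nonneg _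
    have g6 : (N (x' s) / a - a * |φ s| * N (x s)) ^ 2 = N (x' s) ^ 2 / a ^ 2 -
        2 * (|φ s| * (N (x' s) * N (x s))) + a ^ 2 * φ s ^ 2 * N (x s) ^ 2 := by
      rw [← sq_abs (φ s)]; field_simp; ring
    nlinarith
  rw [key] at hpos
  simp only [Pi.sub_apply, Pi.mul_apply] at hpos
  have e1 : ∀ u, φ u * (N (x u) * N (x u)) = φ u * N (x u) ^ 2 := fun u => by ring
  rw [e1, e1] at hpos
  exact sub_nonneg.1 hpos

theorem norm_sub_zero_le_of_hasDerivAt {x x' : ℝ → F} (hx : ∀ s, HasDerivAt x (x' s) s) {C t : ℝ}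
    (hC : ∀ s ∈ Icc 0 t, ‖x' s‖ ≤ C) {s : ℝ} (hs : s ∈ Icc 0 t) : ‖x s - x 0‖ ≤ C * s := by
  simpa using norm_image_sub_le_of_norm_deriv_le_segment' (f := x) (f' := x') (a := 0) (b := t)
    (C := C) (fun u _ => (hx u).hasDerivWithinAt) (fun u hu => hC u (Ico_subset_Icc_self hu)) s hs

/-- The hypotheses shared by the differences of two Hamiltonian trajectories which start from the
same position. -/
structure IsVariation (m M L T : ℝ) (x y x' y' : ℝ → F) : Prop where
  hx : ∀ s, HasDerivAt x (x' s) s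
  hy : ∀ s, HasDerivAt y (y' s) s
  zero : x 0 = 0
  coercive : ∀ s, m * ‖y s‖ ^ 2 ≤ inner ℝ (x' s) (y s)
  norm_x' : ∀ s, ‖x' s‖ ≤ M * ‖y s‖
  norm_y' : ∀ s, ‖y' s‖ ≤ M * ‖x s‖
  norm_x : ∀ s ∈ Icc 0 T, ‖x s‖ ≤ L * ‖y 0‖
  norm_y : ∀ s ∈ Icc 0 T, ‖y s‖ ≤ L * ‖y 0‖

namespace IsVariation

variable {m M L T : ℝ} {x y x' y' : ℝ → F}

theorem norm_x_le (h : IsVariation m M L T x y x' y') (hM : 0 ≤ M) {s : ℝ} (hs : s ∈ Icc 0 T) :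
    ‖x s‖ ≤ M * L * s * ‖y 0‖ := by
  have := norm_sub_zero_le_of_hasDerivAt h.hx (C := M * (L * ‖y 0‖)) (t := T)
    (fun u hu => (h.norm_x' u).trans (by gcongr; exact h.norm_y u hu)) hs
  rw [h.zero, sub_zero] at this
  linarith

theorem norm_y_sub_le (h : IsVariation m M L T x y x' y') (hM : 0 ≤ M) {s : ℝ}
    (hs : s ∈ Icc 0 T) : ‖y s - y 0‖ ≤ M * L * s * ‖y 0‖ := by
  have := norm_sub_zero_le_of_hasDerivAt h.hy (C := M * (L * ‖y 0‖)) (t := T)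
    (fun u hu => (h.norm_y' u).trans (by gcongr; exact h.norm_x u hu)) hs
  linarith

/-- For a short time `y` stays close to `y 0`, so the coercivity of ⟨x', y⟩ passes to ⟨x', y 0⟩ with
half the constant, and integration gives linear growth. -/
theorem le_inner_zero (h : IsVariation m M L T x y x' y') (hm : 0 < m) (hM : 0 < M) (hL : 0 < L)
    {t : ℝ} (ht0 : 0 ≤ t) (htT : t ≤ T) (ht : M * L * t * (4 * (m + M)) ≤ m) :
    m / 2 * t * ‖y 0‖ ^ 2 ≤ inner ℝ (x t) (y 0) := by
  have hd : ∀ s, HasDerivAt (fun u => inner ℝ (x u) (y 0)) (inner ℝ (x' s) (y 0)) s := fun s => by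
    simpa using (h.hx s).inner ℝ (hasDerivAt_const s (y 0))
  have key := (convex_Icc 0 t).mul_sub_le_image_sub_of_le_deriv
    (f := fun u => inner ℝ (x u) (y 0)) (C := m / 2 * ‖y 0‖ ^ 2)
    (fun s _ => (hd s).continuousAt.continuousWithinAt)
    (fun s _ => (hd s).differentiableAt.differentiableWithinAt) (fun s hs => ?_)
    0 (left_mem_Icc.2 ht0) t (right_mem_Icc.2 ht0) ht0
  · simp only [h.zero, inner_zero_left, sub_zero] at key
    linarith
  · rw [(hd s).deriv]
    rw [interior_Icc] at hs
    have hsT : s ∈ Icc 0 T := ⟨hs.1.le, hs.2.le.trans htT⟩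
    set e := M * L * s with he
    have he0 : 0 ≤ e := by have := hs.1.le; positivity
    have het : e ≤ M * L * t := by have := hs.2.le; rw [he]; gcongr
    have he1 : e * (4 * (m + M)) ≤ m := le_trans (by gcongr) ht
    have he2 : e ≤ 1 / 4 := by nlinarith [mul_nonneg he0 hM.le]
    have h1 := h.norm_y_sub_le hM.le hsT
    rw [← he] at h1
    set η := ‖y 0‖
    have hη : 0 ≤ η := norm_nonneg _
    have h2 : ‖y s‖ ≤ (1 + e) * η := by
      have := norm_add_le (y s - y 0) (y 0); rw [sub_add_cancel] at this; linarith
    have h3 : (1 - e) * η ≤ ‖y s‖ := by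
      have := norm_sub_norm_le (y 0) (y s); rw [norm_sub_rev] at this; linarith
    have h4 : inner ℝ (x' s) (y s - y 0) ≤ M * ((1 + e) * η) * (e * η) :=
      (real_inner_le_norm _ _).trans (by gcongr; exact (h.norm_x' s).trans (by gcongr))
    have h5 : inner ℝ (x' s) (y 0) = inner ℝ (x' s) (y s) - inner ℝ (x' s) (y s - y 0) := by
      rw [inner_sub_right]; ring
    have h6 := h.coercive s
    have h7 : ((1 - e) * η) ^ 2 ≤ ‖y s‖ ^ 2 := by
      have : 0 ≤ (1 - e) * η := mul_nonneg (by linarith) hη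
      gcongr
    have h8 : m / 2 ≤ m * (1 - e) ^ 2 - M * (1 + e) * e := by
      nlinarith [mul_nonneg hM.le he0, mul_nonneg hm.le (sq_nonneg e), mul_nonneg hM.le
        (mul_nonneg he0 (sub_nonneg.2 he2))]
    have h9 : m / 2 * η ^ 2 ≤ (m * (1 - e) ^ 2 - M * (1 + e) * e) * η ^ 2 := by gcongr
    nlinarith

end IsVariation

/-- Before the first conjugate time of the comparison oscillator, the position of a Hamiltonian
variation controls its initial momentum. -/
theorem exists_le_norm_of_isVariation {m M L B a T t₀ : ℝ} (hm : 0 < m) (hM : 0 < M) (hL : 0 < L)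
    (hB : 0 ≤ B) (ha : 0 < a) (hT : a * T < Real.pi) (ht₀ : 0 < t₀) (ht₀T : t₀ ≤ T) :
    ∃ c, 0 < c ∧ ∀ (N : Seminorm ℝ F), (∀ v, N v ≤ B * ‖v‖) → ∀ x y x' y' : ℝ → F,
      IsVariation m M L T x y x' y' → Continuous x' → Continuous y' →
      (∀ s, N (x' s) ^ 2 ≤ a ^ 2 * inner ℝ (x' s) (y s)) →
      (∀ s, -inner ℝ (x s) (y' s) ≤ N (x s) ^ 2) →
      ∀ t ∈ Icc t₀ T, c * ‖y 0‖ ≤ ‖x t‖ := by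
  have hT0 : 0 < T := ht₀.trans_le ht₀T
  -- With this shift `a * s + δ` stays in `[δ, π - δ]` on `[0, T]`, so the cotangent is bounded
  -- there, even at time zero.
  set δ := (Real.pi - a * T) / 2 with hδd
  have hδ : 0 < δ := by linarith
  have hδπ : δ < Real.pi / 2 := by have := mul_pos ha hT0; rw [hδd]; linarith
  set σ := Real.sin δ with hσd
  have hσ : 0 < σ := Real.sin_pos_of_pos_of_lt_pi hδ (by linarith [Real.pi_pos])
  have hsin : ∀ s ∈ Icc 0 T, σ ≤ Real.sin (a * s + δ) := by
    intro s hs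
    have h1 : a * s ≤ a * T := by have := hs.2; gcongr
    have h2 : 0 ≤ a * s := mul_nonneg ha.le hs.1
    rcases le_total (a * s + δ) (Real.pi / 2) with h | h
    · exact Real.sin_le_sin_of_le_of_le_pi_div_two (by linarith) h (by linarith)
    · rw [← Real.sin_pi_sub (a * s + δ)]
      exact Real.sin_le_sin_of_le_of_le_pi_div_two (by linarith) (by linarith) (by linarith)
  set P := 1 / (a * σ) with hPd
  have hP : 0 < P := by positivity
  have hφ : ∀ s ∈ Icc 0 T, |Real.cos (a * s + δ) / (a * Real.sin (a * s + δ))| ≤ P := by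
    intro s hs
    have := hsin s hs
    rw [abs_div, abs_of_pos (mul_pos ha (hσ.trans_le this))]
    exact div_le_div₀ zero_le_one (Real.abs_cos_le_one _) (by positivity) (by gcongr)
  -- `D` collects both terms of the corrected form: ⟨x, y⟩ contributes `1` and the cotangent times
  -- N² contributes `P * B ^ 2`.
  set D := 1 + P * B ^ 2 with hD
  have hD0 : 0 < D := by positivity
  -- At `s₀` the main term is at least `m / 2 * s₀ * ‖y 0‖ ^ 2`. All errors are quadratic in `s₀`,
  -- and the last condition makes them at most half of it.
  obtain ⟨s₀, hs0, hst, hs1, hs2⟩ : ∃ s, 0 < s ∧ s ≤ t₀ ∧ M * L * s * (4 * (m + M)) ≤ m ∧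
      s * (M * L) ^ 2 * D ≤ m / 4 := by
    refine ⟨min t₀ (min (m / (M * L * (4 * (m + M)))) (m / 4 / ((M * L) ^ 2 * D))),
      by positivity, min_le_left _ _, ?_, ?_⟩
    · have := (min_le_right t₀ _).trans
        (min_le_left (m / (M * L * (4 * (m + M)))) (m / 4 / ((M * L) ^ 2 * D)))
      rw [le_div_iff₀ (by positivity)] at this
      linarith
    · have := (min_le_right t₀ _).trans
        (min_le_right (m / (M * L * (4 * (m + M)))) (m / 4 / ((M * L) ^ 2 * D)))
      rw [le_div_iff₀ (by positivity)] at this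
      linarith
  refine ⟨m / 4 * s₀ / (L * D), by positivity, ?_⟩
  intro N hN x y x' y' h hx' hy' h1 h2 t ht
  have hNL : LipschitzWith B.toNNReal N := by
    refine LipschitzWith.of_dist_le_mul fun u v => ?_
    rw [Real.dist_eq, dist_eq_norm, Real.coe_toNNReal B hB]
    exact (abs_sub_map_le_sub N u v).trans (hN _)
  set η := ‖y 0‖
  have hη : 0 ≤ η := norm_nonneg _
  have hmono := energy_sub_cot_mono hNL.continuous hNL h.hx h.hy hx' hy' ha hδ hs0.le
    (hst.trans ht.1) (by have := mul_le_mul_of_nonneg_left ht.2 ha.le; linarith) h1 h2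
  have hs0T : s₀ ∈ Icc 0 T := ⟨hs0.le, hst.trans ht₀T⟩
  have htT : t ∈ Icc 0 T := ⟨ht₀.le.trans ht.1, ht.2⟩
  have b1 := h.le_inner_zero hm hM hL hs0.le hs0T.2 hs1
  have bx := h.norm_x_le hM.le hs0T
  have hy0 := h.norm_y_sub_le hM.le hs0T
  have b2 : -(inner ℝ (x s₀) (y s₀ - y 0)) ≤ (M * L * s₀ * η) * (M * L * s₀ * η) :=
    (neg_le_abs _).trans ((abs_real_inner_le_norm _ _).trans (by gcongr))
  have b3 : Real.cos (a * s₀ + δ) / (a * Real.sin (a * s₀ + δ)) * N (x s₀) ^ 2 ≤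
      P * (B * (M * L * s₀ * η)) ^ 2 := by
    refine mul_le_mul ((le_abs_self _).trans (hφ s₀ hs0T)) ?_ (sq_nonneg _) hP.le
    have := apply_nonneg N (x s₀)
    gcongr
    exact (hN _).trans (by gcongr)
  have b4 : inner ℝ (x s₀) (y s₀) = inner ℝ (x s₀) (y 0) + inner ℝ (x s₀) (y s₀ - y 0) := by
    rw [inner_sub_right]; ring
  have b5 : inner ℝ (x t) (y t) ≤ ‖x t‖ * (L * η) :=
    (real_inner_le_norm _ _).trans (by gcongr; exact h.norm_y t htT)
  have b6 : -(Real.cos (a * t + δ) / (a * Real.sin (a * t + δ)) * N (x t) ^ 2) ≤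
      P * (B ^ 2 * (‖x t‖ * (L * η))) := by
    rw [← neg_mul]
    refine mul_le_mul ((neg_le_abs _).trans (hφ t htT)) ?_ (sq_nonneg _) hP.le
    have := apply_nonneg N (x t)
    calc N (x t) ^ 2 ≤ (B * ‖x t‖) ^ 2 := by gcongr; exact hN _
      _ = B ^ 2 * (‖x t‖ * ‖x t‖) := by ring
      _ ≤ _ := by gcongr; exact h.norm_x t htT
  have b7 : s₀ * (M * L) ^ 2 * D * (s₀ * η ^ 2) ≤ m / 4 * (s₀ * η ^ 2) := by gcongr
  have b8 : m / 4 * s₀ * η ^ 2 ≤ L * D * ‖x t‖ * η := by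
    rw [hD] at b7 ⊢
    nlinarith
  rcases hη.eq_or_lt with h0 | h0
  · rw [← h0, mul_zero]; exact norm_nonneg _
  · rw [div_mul_eq_mul_div, div_le_iff₀ (by positivity)]
    refine le_of_mul_le_mul_right ?_ h0
    linarith

end Core

/-! ### Square roots and products of positive operators. -/

section Operators

variable {d : ℕ}

theorem norm_posSqrt_apply_sq {S : E d →L[ℝ] E d} (hS : S.IsPositive) (v : E d) :
    ‖posSqrt S v‖ ^ 2 = inner ℝ v (S v) := by
  obtain ⟨hP, hPP⟩ := posSqrt_spec hS
  rw [← real_inner_self_eq_norm_sq]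
  have h : inner ℝ (posSqrt S v) (posSqrt S v) = inner ℝ v (posSqrt S (posSqrt S v)) :=
    hP.isSymmetric _ _
  rw [h]
  exact congrArg (fun F : E d →L[ℝ] E d => inner ℝ v (F v)) hPP

theorem norm_le_of_isPositive_of_inner_le {S : E d →L[ℝ] E d} (hS : S.IsPositive) {M : ℝ}
    (hM : 0 ≤ M) (h : ∀ v, inner ℝ v (S v) ≤ M * ‖v‖ ^ 2) : ‖S‖ ≤ M := by
  refine S.opNorm_le_bound hM fun v => ?_
  have h1 : ∀ w, ‖posSqrt S w‖ ^ 2 ≤ M * ‖w‖ ^ 2 := fun w =>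
    (norm_posSqrt_apply_sq hS w).trans_le (h w)
  have h2 : S v = posSqrt S (posSqrt S v) :=
    (congrArg (fun F : E d →L[ℝ] E d => F v) (posSqrt_spec hS).2).symm
  refine abs_le_of_sq_le_sq' ?_ (by positivity) |>.2
  rw [h2, mul_pow]
  nlinarith [h1 v, h1 (posSqrt S v)]

theorem inner_apply_le_of_eigenvalue_le {S : E d →L[ℝ] E d} (hS : S.IsPositive) {K : ℝ}
    (h : ∀ (l : ℝ) (e : E d), e ≠ 0 → S e = l • e → l ≤ K) (v : E d) :
    inner ℝ (S v) v ≤ K * ‖v‖ ^ 2 := by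
  have hsym : S.toLinearMap.IsSymmetric := hS.isSymmetric
  set n := Module.finrank ℝ (E d) with hn
  let b := hsym.eigenvectorBasis hn.symm
  have hb : ∀ j, S (b j) = hsym.eigenvalues hn.symm j • b j := fun j =>
    hsym.apply_eigenvectorBasis hn.symm j
  rw [← real_inner_self_eq_norm_sq, ← b.sum_inner_mul_inner (S v) v, ← b.sum_inner_mul_inner v v,
    Finset.mul_sum]
  refine Finset.sum_le_sum fun j _ => ?_
  have h1 : inner ℝ (S v) (b j) = hsym.eigenvalues hn.symm j * inner ℝ v (b j) := by
    have : inner ℝ (S v) (b j) = inner ℝ v (S (b j)) := hsym _ _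
    rw [this, hb, real_inner_smul_right]
  have h2 := h _ _ (b.orthonormal.ne_zero j) (hb j)
  rw [h1, mul_assoc, real_inner_comm v (b j)]
  exact mul_le_mul_of_nonneg_right h2 (mul_self_nonneg _)

/-- A bound on the norm of the product of two positive operators bounds the second one by the
inverse of the first one. -/
theorem inner_comp_le_of_norm_comp_le {V U : E d →L[ℝ] E d} (hV : V.IsPositive)
    (hU : U.IsPositive) {K : ℝ} (hK : ‖V ∘L U‖ ≤ K) (y : E d) :
    inner ℝ (V y) (U (V y)) ≤ K * inner ℝ (V y) y := by
  obtain ⟨hR, hRR⟩ := posSqrt_spec hV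
  set R := posSqrt V
  have hRR' : ∀ w, V w = R (R w) := fun w =>
    (congrArg (fun F : E d →L[ℝ] E d => F w) hRR).symm
  have sR : ∀ v w, inner ℝ (R v) w = inner ℝ v (R w) := fun v w => hR.isSymmetric v w
  have sU : ∀ v w, inner ℝ (U v) w = inner ℝ v (U w) := fun v w => hU.isSymmetric v w
  -- The symmetric operator √V U √V has no nonzero eigenvalue that V U lacks: √V sends its
  -- eigenvectors to eigenvectors of V U. So the norm of V U bounds its quadratic form, which is
  -- then evaluated at √V y.
  have hS : (R ∘L U ∘L R).IsPositive := by
    rw [ContinuousLinearMap.isPositive_iff]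
    refine ⟨fun v w => ?_, fun v => ?_⟩
    · change inner ℝ (R (U (R v))) w = inner ℝ v (R (U (R w)))
      rw [sR, sU, sR]
    · change 0 ≤ inner ℝ (R (U (R v))) v
      rw [sR]
      exact ((ContinuousLinearMap.isPositive_iff U).1 hU).2 _
  have key := inner_apply_le_of_eigenvalue_le hS (K := K) (fun l e he hl => ?_) (R y)
  · change inner ℝ (R (U (R (R y)))) (R y) ≤ _ at key
    rw [← hRR', sR, ← hRR', real_inner_comm] at key
    refine key.trans_eq ?_
    rw [hRR' y, sR, real_inner_self_eq_norm_sq]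
  · change R (U (R e)) = l • e at hl
    have hK0 : 0 ≤ K := (norm_nonneg _).trans hK
    by_cases h0 : R e = 0
    · rw [h0, map_zero, map_zero] at hl
      rw [(smul_eq_zero.1 hl.symm).resolve_right he]
      exact hK0
    · have h1 : (V ∘L U) (R e) = l • R e := by
        rw [ContinuousLinearMap.comp_apply, hRR', hl, map_smul]
      have h2 := ((V ∘L U).le_opNorm (R e)).trans
        (mul_le_mul_of_nonneg_right hK (norm_nonneg _))
      rw [h1, norm_smul] at h2
      exact (le_abs_self l).trans (le_of_mul_le_mul_right h2 (norm_pos_iff.2 h0))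

theorem norm_comp_comm_of_isPositive {V U : E d →L[ℝ] E d} (hV : V.IsPositive)
    (hU : U.IsPositive) : ‖U ∘L V‖ = ‖V ∘L U‖ := by
  rw [← LinearIsometryEquiv.norm_map ContinuousLinearMap.adjoint (V ∘L U),
    ContinuousLinearMap.adjoint_comp, hV.isSelfAdjoint.adjoint_eq, hU.isSelfAdjoint.adjoint_eq]

/-- The conjugations by √U cancel in the square, which leaves V √U √U. Coercivity of U makes √U
invertible, so that `inverse` is a genuine inverse. -/
theorem sqrtMul_comp_self {V U : E d →L[ℝ] E d} (hV : V.IsPositive) (hU : U.IsPositive)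
    {m : ℝ} (hm : 0 < m) (hmU : ∀ v, m * ‖v‖ ^ 2 ≤ inner ℝ v (U v)) :
    sqrtMul V U ∘L sqrtMul V U = V ∘L U := by
  obtain ⟨hR, hRR⟩ := posSqrt_spec hU
  have hn := norm_posSqrt_apply_sq hU
  rw [sqrtMul]
  set R := posSqrt U
  have sR : ∀ v w, inner ℝ (R v) w = inner ℝ v (R w) := fun v w => hR.isSymmetric v w
  have hinj : Function.Injective R := by
    refine (injective_iff_map_eq_zero R).2 fun v hv => ?_
    have h1 := hmU v
    rw [← hn, hv, norm_zero] at h1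
    have h2 : ‖v‖ ^ 2 ≤ 0 := by nlinarith [sq_nonneg ‖v‖]
    exact norm_eq_zero.1 (pow_eq_zero_iff two_ne_zero |>.1 (le_antisymm h2 (sq_nonneg _)))
  have hdet : R.IsInvertible := by
    let e := LinearEquiv.ofInjectiveEndo R.toLinearMap hinj
    exact ⟨e.toContinuousLinearEquiv, by ext v; rfl⟩
  have hS : (R ∘L V ∘L R).IsPositive := by
    rw [ContinuousLinearMap.isPositive_iff]
    refine ⟨fun v w => ?_, fun v => ?_⟩
    · change inner ℝ (R (V (R v))) w = inner ℝ v (R (V (R w)))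
      have : inner ℝ (V (R v)) (R w) = inner ℝ (R v) (V (R w)) := hV.isSymmetric _ _
      rw [sR, this, sR]
    · change 0 ≤ inner ℝ (R (V (R v))) v
      rw [sR]
      exact ((ContinuousLinearMap.isPositive_iff V).1 hV).2 _
  obtain ⟨-, hSS⟩ := posSqrt_spec hS
  set S := posSqrt (R ∘L V ∘L R)
  have i1 : ∀ w, R (R.inverse w) = w := fun w => hdet.self_apply_inverse w
  have i2 : ∀ w, R.inverse (R w) = w := fun w => hdet.inverse_apply_self w
  ext1 v
  have hSS' : ∀ w, S (S w) = R (V (R w)) := fun w =>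
    congrArg (fun F : E d →L[ℝ] E d => F w) hSS
  have hRR' : ∀ w, R (R w) = U w := fun w => congrArg (fun F : E d →L[ℝ] E d => F w) hRR
  simp only [ContinuousLinearMap.comp_apply]
  rw [i1, hSS', i2, hRR']

end Operators

/-! ### Uniformly convex potentials and the norm given by their Hessians. -/

section Potentials

open Set Filter Topology

variable {d : ℕ}

/-- A `C²` potential whose Hessian has its spectrum in `[m, M]` everywhere. -/
structure IsUniformlyConvex (m M : ℝ) (u : E d → ℝ) : Prop where
  contDiff : ContDiff ℝ 2 u
  pos : 0 < m
  le : m ≤ M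
  le_hess : ∀ x v, m * ‖v‖ ^ 2 ≤ inner ℝ v (hess u x v)
  hess_le : ∀ x v, inner ℝ v (hess u x v) ≤ M * ‖v‖ ^ 2

theorem IsStrictlyLogConcaveDensity.exists_isUniformlyConvex {f : E d → ℝ}
    (hf : IsStrictlyLogConcaveDensity f) : ∃ m M, IsUniformlyConvex m M (potential f) := by
  obtain ⟨m, M, hm, h⟩ := hf.hess_bounds
  -- In dimension zero the bounds do not force `m ≤ M`; the maximum does.
  exact ⟨m, max m M, hf.contDiff, hm, le_max_left _ _, fun x v => (h x v).1,
    fun x v => (h x v).2.trans (by gcongr; exact le_max_right _ _)⟩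

namespace IsUniformlyConvex

variable {m M : ℝ} {u : E d → ℝ}

theorem mono (hu : IsUniformlyConvex m M u) {m' M' : ℝ} (hm' : 0 < m') (hm : m' ≤ m)
    (hM : M ≤ M') : IsUniformlyConvex m' M' u where
  contDiff := hu.contDiff
  pos := hm'
  le := hm.trans (hu.le.trans hM)
  le_hess x v := le_trans (by gcongr) (hu.le_hess x v)
  hess_le x v := (hu.hess_le x v).trans (by gcongr)

theorem contDiff_gradient (hu : IsUniformlyConvex m M u) : ContDiff ℝ 1 (gradient u) :=
  (InnerProductSpace.toDual ℝ (E d)).symm.contDiff.comp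
    (hu.contDiff.fderiv_right (m := 1) (by norm_num))

theorem hasGradientAt (hu : IsUniformlyConvex m M u) (x : E d) :
    HasGradientAt u (gradient u x) x :=
  (hu.contDiff.differentiable (by norm_num) x).hasGradientAt

theorem hasFDerivAt_gradient (hu : IsUniformlyConvex m M u) (x : E d) :
    HasFDerivAt (gradient u) (hess u x) x :=
  (hu.contDiff_gradient.differentiable (by norm_num) x).hasFDerivAt

theorem continuous_hess (hu : IsUniformlyConvex m M u) : Continuous (hess u) :=
  hu.contDiff_gradient.continuous_fderiv (by norm_num)

theorem hess_symm (hu : IsUniformlyConvex m M u) (x v w : E d) :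
    inner ℝ (hess u x v) w = inner ℝ v (hess u x w) := by
  have h : IsSymmSndFDerivAt ℝ u x :=
    hu.contDiff.contDiffAt.isSymmSndFDerivAt (by simp)
  have hd : DifferentiableAt ℝ (fderiv ℝ u) x :=
    (hu.contDiff.fderiv_right (m := 1) (by norm_num)).differentiable (by norm_num) x
  have e : ∀ a b, inner ℝ (hess u x a) b = fderiv ℝ (fderiv ℝ u) x a b := by
    intro a b
    have : hess u x =
        (InnerProductSpace.toDual ℝ (E d)).symm.toContinuousLinearEquiv.toContinuousLinearMap ∘L
          fderiv ℝ (fderiv ℝ u) x :=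
      ((InnerProductSpace.toDual ℝ (E d)).symm.toContinuousLinearEquiv.toContinuousLinearMap.hasFDerivAt.comp
        x hd.hasFDerivAt).fderiv
    rw [this]
    exact InnerProductSpace.toDual_symm_apply
  rw [e, real_inner_comm, e, h.eq]

theorem isPositive_hess (hu : IsUniformlyConvex m M u) (x : E d) : (hess u x).IsPositive := by
  rw [ContinuousLinearMap.isPositive_iff]
  refine ⟨fun v w => hu.hess_symm x v w, fun v => ?_⟩
  rw [real_inner_comm]
  exact (mul_nonneg hu.pos.le (sq_nonneg _)).trans (hu.le_hess x v)

theorem norm_hess_le (hu : IsUniformlyConvex m M u) (x : E d) : ‖hess u x‖ ≤ M :=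
  norm_le_of_isPositive_of_inner_le (hu.isPositive_hess x) (hu.pos.le.trans hu.le) (hu.hess_le x)

theorem norm_gradient_sub_le (hu : IsUniformlyConvex m M u) (x y : E d) :
    ‖gradient u x - gradient u y‖ ≤ M * ‖x - y‖ :=
  convex_univ.norm_image_sub_le_of_norm_hasFDerivWithin_le
    (fun z _ => (hu.hasFDerivAt_gradient z).hasFDerivWithinAt) (fun z _ => hu.norm_hess_le z)
    (mem_univ y) (mem_univ x)

theorem hasDerivAt_inner_gradient (hu : IsUniformlyConvex m M u) (x y w : E d) (θ : ℝ) :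
    HasDerivAt (fun θ : ℝ => inner ℝ (gradient u (y + θ • (x - y))) w)
      (inner ℝ (hess u (y + θ • (x - y)) (x - y)) w) θ := by
  have h1 : HasDerivAt (fun θ : ℝ => y + θ • (x - y)) (x - y) θ := by
    simpa using ((hasDerivAt_id θ).smul_const (x - y)).const_add y
  have h2 := (hu.hasFDerivAt_gradient (y + θ • (x - y))).comp_hasDerivAt θ h1
  simpa using h2.inner ℝ (hasDerivAt_const θ w)

theorem inner_gradient_sub_le_of_forall (hu : IsUniformlyConvex m M u) {x y : E d} {K : ℝ}
    (hK : ∀ z, inner ℝ (x - y) (hess u z (x - y)) ≤ K) :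
    inner ℝ (gradient u x - gradient u y) (x - y) ≤ K := by
  have hd := hu.hasDerivAt_inner_gradient x y (x - y)
  have := (convex_Icc (0 : ℝ) 1).image_sub_le_mul_sub_of_deriv_le
    (fun s _ => (hd s).continuousAt.continuousWithinAt)
    (fun s _ => (hd s).differentiableAt.differentiableWithinAt) (C := K)
    (fun s _ => by rw [(hd s).deriv, real_inner_comm]; exact hK _) 0 (by simp) 1 (by simp)
    zero_le_one
  simpa [inner_sub_left] using this

theorem le_inner_gradient_sub (hu : IsUniformlyConvex m M u) (x y : E d) :
    m * ‖x - y‖ ^ 2 ≤ inner ℝ (gradient u x - gradient u y) (x - y) := by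
  have hd := hu.hasDerivAt_inner_gradient x y (x - y)
  have := (convex_Icc (0 : ℝ) 1).mul_sub_le_image_sub_of_le_deriv
    (fun s _ => (hd s).continuousAt.continuousWithinAt)
    (fun s _ => (hd s).differentiableAt.differentiableWithinAt) (C := m * ‖x - y‖ ^ 2)
    (fun s _ => by rw [(hd s).deriv, real_inner_comm]; exact hu.le_hess _ _) 0 (by simp) 1
    (by simp) zero_le_one
  simpa [inner_sub_left] using this

/-- The Hessian of `u` averaged over the segment from `y` to `x`. -/
def segmentHess (u : E d → ℝ) (x y : E d) : E d →L[ℝ] E d :=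
  ∫ θ in (0 : ℝ)..1, hess u (y + θ • (x - y))

theorem continuous_hess_segment (hu : IsUniformlyConvex m M u) (x y : E d) :
    Continuous fun θ : ℝ => hess u (y + θ • (x - y)) :=
  hu.continuous_hess.comp (by fun_prop)

theorem inner_segmentHess_apply (hu : IsUniformlyConvex m M u) (x y v w : E d) :
    inner ℝ (segmentHess u x y v) w =
      ∫ θ in (0 : ℝ)..1, inner ℝ (hess u (y + θ • (x - y)) v) w := by
  have hc := hu.continuous_hess_segment x y
  rw [segmentHess, ContinuousLinearMap.intervalIntegral_apply (hc.intervalIntegrable _ _),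
    real_inner_comm]
  have h := ((innerSL ℝ w).intervalIntegral_comp_comm (μ := volume)
    ((hc.clm_apply continuous_const).intervalIntegrable (0 : ℝ) 1) :
      ∫ θ in (0 : ℝ)..1, innerSL ℝ w (hess u (y + θ • (x - y)) v) = _)
  simp only [innerSL_apply_apply] at h
  rw [← h]
  simp only [real_inner_comm w]

theorem segmentHess_apply_sub (hu : IsUniformlyConvex m M u) (x y : E d) :
    segmentHess u x y (x - y) = gradient u x - gradient u y := by
  refine ext_inner_right ℝ fun w => ?_
  rw [hu.inner_segmentHess_apply, intervalIntegral.integral_eq_sub_of_hasDerivAt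
    (fun θ _ => hu.hasDerivAt_inner_gradient x y w θ)]
  · simp [inner_sub_left]
  · exact ((hu.continuous_hess_segment x y).clm_apply continuous_const).inner
      continuous_const |>.intervalIntegrable _ _

theorem isPositive_segmentHess (hu : IsUniformlyConvex m M u) (x y : E d) :
    (segmentHess u x y).IsPositive := by
  rw [ContinuousLinearMap.isPositive_iff]
  refine ⟨fun v w => ?_, fun v => ?_⟩
  · change inner ℝ (segmentHess u x y v) w = inner ℝ v (segmentHess u x y w)
    rw [real_inner_comm _ v, hu.inner_segmentHess_apply, hu.inner_segmentHess_apply]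
    simp only [hu.hess_symm _ v w, real_inner_comm v]
  · rw [hu.inner_segmentHess_apply]
    refine intervalIntegral.integral_nonneg zero_le_one fun θ _ => ?_
    exact ((ContinuousLinearMap.isPositive_iff _).1 (hu.isPositive_hess _)).2 v

/-- A norm bound is convex in the left factor, so it survives averaging over the segment. -/
theorem norm_segmentHess_comp_le (hu : IsUniformlyConvex m M u) {K : ℝ} {W : E d →L[ℝ] E d}
    (hK : ∀ z, ‖hess u z ∘L W‖ ≤ K) (x y : E d) : ‖segmentHess u x y ∘L W‖ ≤ K := by
  have h := ((ContinuousLinearMap.compL ℝ (E d) (E d) (E d)).flip W).intervalIntegral_comp_comm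
    (μ := volume) ((hu.continuous_hess_segment x y).intervalIntegrable (0 : ℝ) 1)
  simp only [ContinuousLinearMap.flip_apply, ContinuousLinearMap.compL_apply] at h
  rw [segmentHess, ← h]
  simpa using intervalIntegral.norm_integral_le_of_norm_le_const (a := (0 : ℝ)) (b := 1)
    (C := K) (f := fun θ : ℝ => hess u (y + θ • (x - y)) ∘L W) fun θ _ => hK _

/-- The supremum over all base points of the norms defined by the Hessian of `u`. -/
def hessSeminorm (u : E d → ℝ) : Seminorm ℝ (E d) :=
  ⨆ q : E d, (normSeminorm ℝ (E d)).comp (posSqrt (hess u q)).toLinearMap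

theorem norm_posSqrt_hess_le (hu : IsUniformlyConvex m M u) (q v : E d) :
    ‖posSqrt (hess u q) v‖ ≤ √M * ‖v‖ := by
  refine abs_le_of_sq_le_sq' ?_ (by positivity) |>.2
  rw [norm_posSqrt_apply_sq (hu.isPositive_hess q), mul_pow,
    Real.sq_sqrt (hu.pos.le.trans hu.le)]
  exact hu.hess_le q v

theorem hessSeminorm_apply (hu : IsUniformlyConvex m M u) (v : E d) :
    hessSeminorm u v = ⨆ q : E d, ‖posSqrt (hess u q) v‖ := by
  rw [hessSeminorm, Seminorm.iSup_apply]
  · rfl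
  · rw [Seminorm.bddAbove_range_iff]
    intro v
    exact ⟨√M * ‖v‖, by rintro _ ⟨q, rfl⟩; exact hu.norm_posSqrt_hess_le q v⟩

theorem hessSeminorm_le (hu : IsUniformlyConvex m M u) (v : E d) :
    hessSeminorm u v ≤ √M * ‖v‖ := by
  rw [hu.hessSeminorm_apply]
  exact ciSup_le fun q => hu.norm_posSqrt_hess_le q v

theorem inner_hess_le_hessSeminorm_sq (hu : IsUniformlyConvex m M u) (q v : E d) :
    inner ℝ v (hess u q v) ≤ hessSeminorm u v ^ 2 := by
  rw [← norm_posSqrt_apply_sq (hu.isPositive_hess q), hu.hessSeminorm_apply]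
  gcongr
  exact le_ciSup (f := fun q => ‖posSqrt (hess u q) v‖)
    ⟨√M * ‖v‖, by rintro _ ⟨q, rfl⟩; exact hu.norm_posSqrt_hess_le q v⟩ q

theorem hessSeminorm_sq_le (hu : IsUniformlyConvex m M u) {v : E d} {K : ℝ}
    (hK : ∀ q, inner ℝ v (hess u q v) ≤ K) : hessSeminorm u v ^ 2 ≤ K := by
  have hK0 : 0 ≤ K := (mul_nonneg hu.pos.le (sq_nonneg _)).trans ((hu.le_hess 0 v).trans (hK 0))
  rw [← Real.sq_sqrt hK0]
  gcongr
  rw [hu.hessSeminorm_apply]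
  refine ciSup_le fun q => Real.le_sqrt_of_sq_le ?_
  rw [norm_posSqrt_apply_sq (hu.isPositive_hess q)]
  exact hK q

theorem inner_gradient_sub_le_hessSeminorm_sq (hu : IsUniformlyConvex m M u) (x y : E d) :
    inner ℝ (gradient u x - gradient u y) (x - y) ≤ hessSeminorm u (x - y) ^ 2 :=
  hu.inner_gradient_sub_le_of_forall fun z => hu.inner_hess_le_hessSeminorm_sq z (x - y)

/-- The difference of gradients is the averaged Hessian H of `v` applied to x - y. Since the norm of
H U''(q) is at most K for each q, `inner_comp_le_of_norm_comp_le` bounds every term of the supremum.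
-/
theorem hessSeminorm_gradient_sub_sq_le {m₁ M₁ : ℝ} {v : E d → ℝ} (hu : IsUniformlyConvex m M u)
    (hv : IsUniformlyConvex m₁ M₁ v) {K : ℝ} (hK : ∀ p q, ‖hess v p ∘L hess u q‖ ≤ K) (x y : E d) :
    hessSeminorm u (gradient v x - gradient v y) ^ 2 ≤
      K * inner ℝ (gradient v x - gradient v y) (x - y) := by
  refine hu.hessSeminorm_sq_le fun q => ?_
  rw [← hv.segmentHess_apply_sub]
  exact inner_comp_le_of_norm_comp_le (hv.isPositive_segmentHess x y) (hu.isPositive_hess q)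
    (hv.norm_segmentHess_comp_le (fun z => hK z q) x y) (x - y)

end IsUniformlyConvex

end Potentials

/-! ### Surjectivity by contraction arguments. -/

section Surjectivity

variable {F : Type*} [NormedAddCommGroup F] [InnerProductSpace ℝ F] [CompleteSpace F]

/-- A Lipschitz strongly monotone map of a Hilbert space is onto. -/
theorem surjective_of_lipschitz_of_monotone {G : F → F} {L c : ℝ} (hL : 0 < L) (hc : 0 < c)
    (hG : ∀ x y, ‖G x - G y‖ ≤ L * ‖x - y‖)
    (hm : ∀ x y, c * ‖x - y‖ ^ 2 ≤ inner ℝ (G x - G y) (x - y)) : Function.Surjective G := by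
  intro y
  -- This step minimises `1 - 2 * h * c + h ^ 2 * L ^ 2`, the squared contraction factor of x ↦ x -
  -- h (G x - y).
  set h := c / L ^ 2 with hh
  have hh0 : 0 < h := by positivity
  -- On a trivial space `c > L` is possible, so the factor is cut off at zero.
  set κ := max (1 - c ^ 2 / L ^ 2) 0 with hκ
  have hκ1 : κ < 1 := max_lt (by have : 0 < c ^ 2 / L ^ 2 := by positivity
                                 linarith) one_pos
  have hκ0 : 0 ≤ κ := le_max_right _ _
  let S : F → F := fun x => x - h • (G x - y)
  have hS : ContractingWith (Real.toNNReal (√κ)) S := by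
    refine ⟨by rw [Real.toNNReal_lt_one]; exact (Real.sqrt_lt' one_pos).2 (by simpa using hκ1),
      LipschitzWith.of_dist_le_mul fun a b => ?_⟩
    rw [dist_eq_norm, dist_eq_norm, Real.coe_toNNReal _ (Real.sqrt_nonneg _)]
    refine abs_le_of_sq_le_sq' ?_ (by positivity) |>.2
    have e : S a - S b = (a - b) - h • (G a - G b) := by simp only [S]; module
    rw [e, mul_pow, Real.sq_sqrt hκ0, norm_sub_sq_real, real_inner_smul_right, norm_smul,
      Real.norm_of_nonneg hh0.le, real_inner_comm]
    have h1 := hm a b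
    have h2 : ‖G a - G b‖ ^ 2 ≤ (L * ‖a - b‖) ^ 2 := by gcongr; exact hG a b
    calc ‖a - b‖ ^ 2 - 2 * (h * inner ℝ (G a - G b) (a - b)) + (h * ‖G a - G b‖) ^ 2
        ≤ ‖a - b‖ ^ 2 - 2 * (h * (c * ‖a - b‖ ^ 2)) + h ^ 2 * (L * ‖a - b‖) ^ 2 := by
          rw [mul_pow]; gcongr
      _ = (1 - c ^ 2 / L ^ 2) * ‖a - b‖ ^ 2 := by rw [hh]; field_simp; ring
      _ ≤ κ * ‖a - b‖ ^ 2 := by gcongr; exact le_max_left _ _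
  refine ⟨hS.fixedPoint S, ?_⟩
  have := hS.fixedPoint_isFixedPt
  have h3 : h • (G (hS.fixedPoint S) - y) = 0 := by
    have h4 : hS.fixedPoint S - h • (G (hS.fixedPoint S) - y) = hS.fixedPoint S := this
    exact sub_eq_self.1 h4
  exact sub_eq_zero.1 ((smul_eq_zero.1 h3).resolve_left hh0.ne')

end Surjectivity

section Surjectivity

variable {F : Type*} [NormedAddCommGroup F] [CompleteSpace F]

/-- An expanding surjection stays onto under a perturbation of smaller Lipschitz constant. -/
theorem surjective_of_lipschitz_sub {G G' : F → F} {c K : ℝ} (hK0 : 0 ≤ K) (hKc : K < c)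
    (hG : Function.Surjective G) (hexp : ∀ x y, c * ‖x - y‖ ≤ ‖G x - G y‖)
    (hsub : ∀ x y, ‖(G' x - G x) - (G' y - G y)‖ ≤ K * ‖x - y‖) : Function.Surjective G' := by
  intro y
  have hc : 0 < c := hK0.trans_lt hKc
  -- A fixed point satisfies G x = y - (G' x - G x), that is G' x = y.
  let S : F → F := fun x => Function.surjInv hG (y - (G' x - G x))
  have hS : ContractingWith (Real.toNNReal (K / c)) S := by
    refine ⟨by rw [Real.toNNReal_lt_one]; exact (div_lt_one hc).2 hKc,
      LipschitzWith.of_dist_le_mul fun a b => ?_⟩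
    rw [dist_eq_norm, dist_eq_norm, Real.coe_toNNReal _ (by positivity), div_mul_eq_mul_div,
      le_div_iff₀ hc, mul_comm]
    refine (hexp _ _).trans ?_
    simp only [S, Function.surjInv_eq]
    rw [sub_sub_sub_cancel_left, norm_sub_rev]
    exact hsub a b
  refine ⟨hS.fixedPoint S, ?_⟩
  have h1 : S (hS.fixedPoint S) = hS.fixedPoint S := hS.fixedPoint_isFixedPt
  have h2 : G (S (hS.fixedPoint S)) = y - (G' (hS.fixedPoint S) - G (hS.fixedPoint S)) :=
    Function.surjInv_eq hG _
  rw [h1] at h2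
  have h3 := eq_sub_iff_add_eq.1 h2
  rwa [add_sub_cancel] at h3

end Surjectivity

/-! ### Existence of the minimiser and quadratic growth around it. -/

namespace IsUniformlyConvex

open Set

variable {d : ℕ} {m M : ℝ} {u : E d → ℝ}

theorem pos' (hu : IsUniformlyConvex m M u) : 0 < M := hu.pos.trans_le hu.le

theorem exists_gradient_eq_zero (hu : IsUniformlyConvex m M u) : ∃ x, gradient u x = 0 :=
  surjective_of_lipschitz_of_monotone hu.pos' hu.pos hu.norm_gradient_sub_le
    hu.le_inner_gradient_sub 0

theorem hasDerivAt_segment (hu : IsUniformlyConvex m M u) (x y : E d) (θ : ℝ) :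
    HasDerivAt (fun θ : ℝ => u (y + θ • (x - y)))
      (inner ℝ (gradient u (y + θ • (x - y))) (x - y)) θ := by
  have h1 : HasDerivAt (fun θ : ℝ => y + θ • (x - y)) (x - y) θ := by
    simpa using ((hasDerivAt_id θ).smul_const (x - y)).const_add y
  have h2 := (hu.hasGradientAt (y + θ • (x - y))).hasFDerivAt.comp_hasDerivAt θ h1
  rwa [InnerProductSpace.toDual_apply_apply] at h2

theorem le_sub_of_gradient_eq_zero (hu : IsUniformlyConvex m M u) {y : E d}
    (hy : gradient u y = 0) (x : E d) : m / 2 * ‖x - y‖ ^ 2 ≤ u x - u y := by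
  have hd : ∀ θ : ℝ, HasDerivAt (fun θ : ℝ => u (y + θ • (x - y)) - m / 2 * ‖x - y‖ ^ 2 * θ ^ 2)
      (inner ℝ (gradient u (y + θ • (x - y))) (x - y) - m / 2 * ‖x - y‖ ^ 2 * (2 * θ)) θ := by
    intro θ
    exact (hu.hasDerivAt_segment x y θ).fun_sub
      ((by simpa using hasDerivAt_pow 2 θ : HasDerivAt (fun θ : ℝ => θ ^ 2) (2 * θ) θ).const_mul _)
  have := (convex_Icc (0 : ℝ) 1).mul_sub_le_image_sub_of_le_deriv
    (fun s _ => (hd s).continuousAt.continuousWithinAt)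
    (fun s _ => (hd s).differentiableAt.differentiableWithinAt) (C := 0)
    (fun s hs => ?_) 0 (by simp) 1 (by simp) zero_le_one
  · simp at this
    linarith
  · rw [interior_Icc] at hs
    rw [(hd s).deriv]
    have h := hu.le_inner_gradient_sub (y + s • (x - y)) y
    rw [hy, sub_zero, add_sub_cancel_left, norm_smul, real_inner_smul_right,
      Real.norm_of_nonneg hs.1.le] at h
    have h2 : s * (m * s * ‖x - y‖ ^ 2) ≤
        s * inner ℝ (gradient u (y + s • (x - y))) (x - y) := by linarith
    have := le_of_mul_le_mul_left h2 hs.1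
    linarith

theorem sub_le_of_gradient_eq_zero (hu : IsUniformlyConvex m M u) {y : E d}
    (hy : gradient u y = 0) (x : E d) : u x - u y ≤ M / 2 * ‖x - y‖ ^ 2 := by
  have hd : ∀ θ : ℝ, HasDerivAt (fun θ : ℝ => u (y + θ • (x - y)) - M / 2 * ‖x - y‖ ^ 2 * θ ^ 2)
      (inner ℝ (gradient u (y + θ • (x - y))) (x - y) - M / 2 * ‖x - y‖ ^ 2 * (2 * θ)) θ := by
    intro θ
    exact (hu.hasDerivAt_segment x y θ).fun_sub
      ((by simpa using hasDerivAt_pow 2 θ : HasDerivAt (fun θ : ℝ => θ ^ 2) (2 * θ) θ).const_mul _)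
  have := (convex_Icc (0 : ℝ) 1).image_sub_le_mul_sub_of_deriv_le
    (fun s _ => (hd s).continuousAt.continuousWithinAt)
    (fun s _ => (hd s).differentiableAt.differentiableWithinAt) (C := 0)
    (fun s hs => ?_) 0 (by simp) 1 (by simp) zero_le_one
  · simp at this
    linarith
  · rw [interior_Icc] at hs
    rw [(hd s).deriv]
    have h := hu.norm_gradient_sub_le (y + s • (x - y)) y
    rw [hy, sub_zero, add_sub_cancel_left, norm_smul, Real.norm_of_nonneg hs.1.le] at h
    have h2 := (real_inner_le_norm (gradient u (y + s • (x - y))) (x - y)).trans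
      (mul_le_mul_of_nonneg_right h (norm_nonneg _))
    linarith

end IsUniformlyConvex

/-! ### Separable flows and convergence of the symplectic Euler method. -/

section SeparableFlow

open Set Filter Topology

variable {F : Type*} [NormedAddCommGroup F] [InnerProductSpace ℝ F]

/-- `Φ` is the flow of `Q' = A P`, `P' = B Q`, for maps `A` and `B` of Lipschitz constant `K`. -/
structure IsSeparableFlow (K : NNReal) (A B : F → F) (Φ : ℝ → F × F → F × F) : Prop where
  lipschitz_left : LipschitzWith K A
  lipschitz_right : LipschitzWith K B
  zero : ∀ z, Φ 0 z = z
  deriv : ∀ z t, HasDerivAt (fun s => Φ s z) (A (Φ t z).2, B (Φ t z).1) t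

/-- One step of the symplectic Euler method. -/
def eulerStep (A B : F → F) (h : ℝ) (z : F × F) : F × F :=
  (z.1 + h • A z.2, z.2 + h • B (z.1 + h • A z.2))

/-- Stability of the scheme; the exponential form multiplies up to `exp (2 K t)` over all steps,
whatever their number. -/
theorem norm_eulerStep_sub_le {K : NNReal} {A B : F → F} (hA : LipschitzWith K A)
    (hB : LipschitzWith K B) {h : ℝ} (hh : 0 ≤ h) (z w : F × F) :
    ‖eulerStep A B h z - eulerStep A B h w‖ ≤ Real.exp (2 * K * h) * ‖z - w‖ := by
  have hA' := fun x y => hA.norm_sub_le x y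
  have hB' := fun x y => hB.norm_sub_le x y
  have h1 : ‖z.1 - w.1‖ ≤ ‖z - w‖ := norm_fst_le (z - w)
  have h2 : ‖z.2 - w.2‖ ≤ ‖z - w‖ := norm_snd_le (z - w)
  have hK : (0 : ℝ) ≤ K := K.2
  have e1 : ‖(z.1 + h • A z.2) - (w.1 + h • A w.2)‖ ≤ (1 + K * h) * ‖z - w‖ := by
    have : (z.1 + h • A z.2) - (w.1 + h • A w.2) = (z.1 - w.1) + h • (A z.2 - A w.2) := by module
    rw [this]
    calc _ ≤ ‖z.1 - w.1‖ + ‖h • (A z.2 - A w.2)‖ := norm_add_le _ _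
      _ ≤ ‖z - w‖ + h * (K * ‖z - w‖) := by
        rw [norm_smul, Real.norm_of_nonneg hh]
        gcongr
        exact (hA' _ _).trans (by gcongr)
      _ = _ := by ring
  have e2 : ‖(z.2 + h • B (z.1 + h • A z.2)) - (w.2 + h • B (w.1 + h • A w.2))‖ ≤
      (1 + K * h) ^ 2 * ‖z - w‖ := by
    have : (z.2 + h • B (z.1 + h • A z.2)) - (w.2 + h • B (w.1 + h • A w.2)) =
      (z.2 - w.2) + h • (B (z.1 + h • A z.2) - B (w.1 + h • A w.2)) := by module
    rw [this]
    calc _ ≤ ‖z.2 - w.2‖ + ‖h • (B (z.1 + h • A z.2) - B (w.1 + h • A w.2))‖ := norm_add_le _ _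
      _ ≤ ‖z - w‖ + h * (K * ((1 + K * h) * ‖z - w‖)) := by
        rw [norm_smul, Real.norm_of_nonneg hh]
        gcongr
        exact (hB' _ _).trans (by gcongr)
      _ ≤ _ := by
        have : 0 ≤ K * h * ‖z - w‖ := by positivity
        nlinarith
  have e3 : (1 + K * h) ^ 2 ≤ Real.exp (2 * K * h) := by
    have := Real.add_one_le_exp (K * h)
    have e : Real.exp (2 * K * h) = Real.exp (K * h) ^ 2 := by rw [← Real.exp_nat_mul]; ring_nf
    rw [e]
    gcongr
    linarith
  have hz := norm_nonneg (z - w)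
  have hKh : 0 ≤ K * h := by positivity
  refine norm_prod_le_iff.2 ⟨e1.trans ?_, e2.trans ?_⟩
  · refine mul_le_mul_of_nonneg_right (le_trans ?_ e3) hz
    nlinarith
  · gcongr

namespace IsSeparableFlow

variable {K : NNReal} {A B : F → F} {Φ : ℝ → F × F → F × F}

/-- Reduces statements about negative times to positive ones. -/
theorem reverse (h : IsSeparableFlow K A B Φ) :
    IsSeparableFlow K (fun x => -A x) (fun x => -B x) (fun t => Φ (-t)) where
  lipschitz_left := h.lipschitz_left.neg
  lipschitz_right := h.lipschitz_right.neg
  zero z := by rw [neg_zero, h.zero]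
  deriv z t := by
    have := (h.deriv z (-t)).scomp t (hasDerivAt_neg t)
    rw [neg_smul, one_smul] at this
    exact this

theorem hasDerivAt_fst (h : IsSeparableFlow K A B Φ) (z : F × F) (t : ℝ) :
    HasDerivAt (fun s => (Φ s z).1) (A (Φ t z).2) t :=
  (ContinuousLinearMap.fst ℝ F F).hasFDerivAt.comp_hasDerivAt t (h.deriv z t)

theorem hasDerivAt_snd (h : IsSeparableFlow K A B Φ) (z : F × F) (t : ℝ) :
    HasDerivAt (fun s => (Φ s z).2) (B (Φ t z).1) t :=
  (ContinuousLinearMap.snd ℝ F F).hasFDerivAt.comp_hasDerivAt t (h.deriv z t)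

theorem continuous_time (h : IsSeparableFlow K A B Φ) (z : F × F) : Continuous fun t => Φ t z :=
  continuous_iff_continuousAt.2 fun t => (h.deriv z t).continuousAt

theorem lipschitz_field (h : IsSeparableFlow K A B Φ) :
    LipschitzWith K fun z : F × F => (A z.2, B z.1) := by
  have h1 : LipschitzWith K fun z : F × F => A z.2 := by
    have := h.lipschitz_left.comp (LipschitzWith.prod_snd (α := F) (β := F))
    rwa [mul_one] at this
  have h2 : LipschitzWith K fun z : F × F => B z.1 := by
    have := h.lipschitz_right.comp (LipschitzWith.prod_fst (α := F) (β := F))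
    rwa [mul_one] at this
  simpa using h1.prodMk h2

theorem dist_le (h : IsSeparableFlow K A B Φ) {t : ℝ} (ht : 0 ≤ t) (z w : F × F) :
    dist (Φ t z) (Φ t w) ≤ dist z w * Real.exp (K * t) := by
  have := dist_le_of_trajectories_ODE (v := fun _ z => (A z.2, B z.1)) (a := 0) (b := t)
    (f := fun s => Φ s z) (g := fun s => Φ s w) (δ := dist z w) (fun _ => h.lipschitz_field)
    (h.continuous_time z).continuousOn (fun s _ => (h.deriv z s).hasDerivWithinAt)
    (h.continuous_time w).continuousOn (fun s _ => (h.deriv w s).hasDerivWithinAt)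
    (by rw [h.zero, h.zero]) t ⟨ht, le_rfl⟩
  simpa using this

theorem eq_of_hasDerivAt (h : IsSeparableFlow K A B Φ) {γ : ℝ → F × F}
    (hγ : ∀ t, HasDerivAt γ (A (γ t).2, B (γ t).1) t) (t : ℝ) : γ t = Φ t (γ 0) := by
  have := ODE_solution_unique_univ (v := fun _ z => (A z.2, B z.1)) (s := fun _ => univ)
    (f := γ) (g := fun s => Φ s (γ 0)) (t₀ := 0) (fun _ => h.lipschitz_field.lipschitzOnWith)
    (fun t => ⟨hγ t, mem_univ _⟩) (fun t => ⟨h.deriv _ t, mem_univ _⟩) (h.zero _).symm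
  exact congrFun this t

theorem add (h : IsSeparableFlow K A B Φ) (s t : ℝ) (z : F × F) : Φ (s + t) z = Φ s (Φ t z) := by
  have := h.eq_of_hasDerivAt (γ := fun s => Φ (s + t) z)
    (fun s => (h.deriv z (s + t)).comp_add_const s t) s
  simpa using this

theorem continuous_space (h : IsSeparableFlow K A B Φ) (t : ℝ) : Continuous (Φ t) := by
  have aux : ∀ {A' B' : F → F} {Ψ : ℝ → F × F → F × F}, IsSeparableFlow K A' B' Ψ →
      ∀ s, 0 ≤ s → Continuous (Ψ s) := fun hΨ s hs =>
    (LipschitzWith.of_dist_le_mul (K := (Real.exp (K * s)).toNNReal) fun z w => by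
      rw [Real.coe_toNNReal _ (Real.exp_pos _).le, mul_comm]; exact hΨ.dist_le hs z w).continuous
  rcases le_total 0 t with ht | ht
  · exact aux h t ht
  · simpa using aux h.reverse (-t) (by linarith)

/-- Consistency of the scheme: within time `t` the flow moves by at most `R * t`, so the velocities
used are wrong by order `t`, and the step by order `t ^ 2`. -/
theorem norm_sub_eulerStep_le (h : IsSeparableFlow K A B Φ) {t R : ℝ} (ht : 0 ≤ t) (z : F × F)
    (hA : ∀ s ∈ Icc 0 t, ‖A (Φ s z).2‖ ≤ R) (hB : ∀ s ∈ Icc 0 t, ‖B (Φ s z).1‖ ≤ R) :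
    ‖eulerStep A B t z - Φ t z‖ ≤ 2 * K * R * t ^ 2 := by
  have hR : 0 ≤ R := (norm_nonneg _).trans (hA 0 ⟨le_rfl, ht⟩)
  have hK : (0 : ℝ) ≤ K := K.2
  have tt : t ∈ Icc 0 t := ⟨ht, le_rfl⟩
  have b1 : ∀ s ∈ Icc 0 t, ‖(Φ s z).1 - z.1‖ ≤ R * t := fun s hs => by
    have := norm_sub_zero_le_of_hasDerivAt (h.hasDerivAt_fst z) hA hs
    rw [h.zero] at this
    exact this.trans (by gcongr; exact hs.2)
  have b2 : ∀ s ∈ Icc 0 t, ‖(Φ s z).2 - z.2‖ ≤ R * t := fun s hs => by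
    have := norm_sub_zero_le_of_hasDerivAt (h.hasDerivAt_snd z) hB hs
    rw [h.zero] at this
    exact this.trans (by gcongr; exact hs.2)
  have hA0 : ‖A z.2‖ ≤ R := by simpa [h.zero] using hA 0 ⟨le_rfl, ht⟩
  have d1 : ∀ s, HasDerivAt (fun s => (Φ s z).1 - s • A z.2) (A (Φ s z).2 - A z.2) s := fun s => by
    simpa using (h.hasDerivAt_fst z s).fun_sub ((hasDerivAt_id s).smul_const (A z.2))
  set q := z.1 + t • A z.2 with hq
  have d2 : ∀ s, HasDerivAt (fun s => (Φ s z).2 - s • B q) (B (Φ s z).1 - B q) s := fun s => by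
    simpa using (h.hasDerivAt_snd z s).fun_sub ((hasDerivAt_id s).smul_const (B q))
  have e1 := norm_sub_zero_le_of_hasDerivAt d1 (C := K * (R * t)) (t := t)
    (fun s hs => (h.lipschitz_left.norm_sub_le _ _).trans (by gcongr; exact b2 s hs)) tt
  have e2 := norm_sub_zero_le_of_hasDerivAt d2 (C := K * (2 * R * t)) (t := t)
    (fun s hs => (h.lipschitz_right.norm_sub_le _ _).trans (by
      gcongr
      have : (Φ s z).1 - q = ((Φ s z).1 - z.1) - t • A z.2 := by rw [hq]; abel
      rw [this]
      refine (norm_sub_le _ _).trans ?_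
      rw [norm_smul, Real.norm_of_nonneg ht]
      have := b1 s hs
      have := mul_le_mul_of_nonneg_left hA0 ht
      linarith)) tt
  rw [norm_sub_rev]
  refine norm_prod_le_iff.2 ⟨?_, ?_⟩
  · have : (Φ t z - eulerStep A B t z).1 = (Φ t z).1 - t • A z.2 - ((Φ 0 z).1 - (0 : ℝ) • A z.2) := by
      rw [h.zero]; simp [eulerStep]; abel
    rw [this]
    refine e1.trans ?_
    have : 0 ≤ K * R * t ^ 2 := by positivity
    nlinarith
  · have : (Φ t z - eulerStep A B t z).2 = (Φ t z).2 - t • B q - ((Φ 0 z).2 - (0 : ℝ) • B q) := by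
      rw [h.zero]; simp [eulerStep, hq]; abel
    rw [this]
    refine e2.trans (le_of_eq ?_)
    ring

/-- The symplectic Euler method converges to the flow. -/
theorem tendsto_eulerStep_iterate (h : IsSeparableFlow K A B Φ) {t : ℝ} (ht : 0 ≤ t)
    (z : F × F) :
    Tendsto (fun n : ℕ => (eulerStep A B (t / n))^[n] z) atTop (𝓝 (Φ t z)) := by
  have hK : (0 : ℝ) ≤ K := K.2
  obtain ⟨R₁, hR₁⟩ := (isCompact_Icc (a := 0) (b := t)).exists_bound_of_continuousOn
    (h.lipschitz_left.continuous.comp (continuous_snd.comp (h.continuous_time z))).continuousOn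
  obtain ⟨R₂, hR₂⟩ := (isCompact_Icc (a := 0) (b := t)).exists_bound_of_continuousOn
    (h.lipschitz_right.continuous.comp (continuous_fst.comp (h.continuous_time z))).continuousOn
  set R := max R₁ R₂
  have hR : 0 ≤ R := (norm_nonneg _).trans ((hR₁ 0 ⟨le_rfl, ht⟩).trans (le_max_left _ _))
  have key : ∀ n : ℕ, 0 < n →
      ‖(eulerStep A B (t / n))^[n] z - Φ t z‖ ≤ 2 * K * R * t ^ 2 * Real.exp (2 * K * t) / n := by
    intro n hn
    have hn' : (0 : ℝ) < n := by exact_mod_cast hn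
    set δ := t / n with hδ
    have hδ0 : 0 ≤ δ := by positivity
    -- Each step adds one local error and stretches the earlier ones by the stability factor.
    have step : ∀ k : ℕ, k ≤ n → ‖(eulerStep A B δ)^[k] z - Φ (k * δ) z‖ ≤
        k * (2 * K * R * δ ^ 2) * Real.exp (2 * K * (k * δ)) := by
      intro k
      induction k with
      | zero => intro _; simp [h.zero]
      | succ k ih =>
        intro hk
        have ih := ih (by omega)
        rw [Function.iterate_succ_apply']
        have e : Φ ((k + 1 : ℕ) * δ) z = Φ δ (Φ (k * δ) z) := by
          rw [← h.add]; push_cast; ring_nf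
        have hmem : ∀ s ∈ Icc 0 δ, s + k * δ ∈ Icc 0 t := fun s hs => by
          refine ⟨add_nonneg hs.1 (by positivity), ?_⟩
          have : ((k + 1 : ℕ) : ℝ) * δ ≤ n * δ := by gcongr
          rw [hδ, mul_div_cancel₀ _ hn'.ne', ← hδ] at this
          push_cast at this
          linarith [hs.2]
        have loc := h.norm_sub_eulerStep_le hδ0 (Φ (k * δ) z) (R := R)
          (fun s hs => by
            rw [← h.add]; exact (hR₁ _ (hmem s hs)).trans (le_max_left _ _))
          (fun s hs => by
            rw [← h.add]; exact (hR₂ _ (hmem s hs)).trans (le_max_right _ _))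
        have lip := norm_eulerStep_sub_le h.lipschitz_left h.lipschitz_right hδ0
          ((eulerStep A B δ)^[k] z) (Φ (k * δ) z)
        rw [e]
        set c := 2 * K * R * δ ^ 2
        have hc : 0 ≤ c := by positivity
        have ex : Real.exp (2 * K * ((k + 1 : ℕ) * δ)) =
            Real.exp (2 * K * δ) * Real.exp (2 * K * (k * δ)) := by
          rw [← Real.exp_add]; push_cast; ring_nf
        have ex1 : 1 ≤ Real.exp (2 * K * ((k + 1 : ℕ) * δ)) := Real.one_le_exp (by positivity)
        calc _ ≤ ‖eulerStep A B δ ((eulerStep A B δ)^[k] z) - eulerStep A B δ (Φ (k * δ) z)‖ +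
              ‖eulerStep A B δ (Φ (k * δ) z) - Φ δ (Φ (k * δ) z)‖ := norm_sub_le_norm_sub_add_norm_sub _ _ _
          _ ≤ Real.exp (2 * K * δ) * (k * c * Real.exp (2 * K * (k * δ))) +
              c * Real.exp (2 * K * ((k + 1 : ℕ) * δ)) := by
            refine add_le_add (lip.trans (by gcongr)) (loc.trans ?_)
            exact le_mul_of_one_le_right hc ex1
          _ = _ := by rw [ex]; push_cast; ring
    have := step n le_rfl
    rw [hδ, mul_div_cancel₀ _ hn'.ne', ← hδ] at this
    refine this.trans (le_of_eq ?_)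
    rw [hδ]; field_simp
  rw [tendsto_iff_norm_sub_tendsto_zero]
  refine squeeze_zero' (Eventually.of_forall fun _ => norm_nonneg _)
    ((eventually_gt_atTop 0).mono key) ?_
  exact tendsto_const_div_atTop_nhds_zero_nat _

end IsSeparableFlow

end SeparableFlow

/-! ### Preservation of volume. -/

section Liouville

open Set Filter Topology

variable {d : ℕ} {K : NNReal} {A B : E d → E d} {Φ : ℝ → E d × E d → E d × E d}

/-- The step is a product of two shears, each of which translates one coordinate by a function of
the other. Volume is thus preserved without any Jacobian. -/
theorem measurePreserving_eulerStep (hA : Continuous A) (hB : Continuous B) (h : ℝ) :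
    MeasurePreserving (eulerStep A B h) volume volume := by
  have shear : ∀ {C : E d → E d}, Continuous C →
      MeasurePreserving (fun z : E d × E d => (z.1, z.2 + h • C z.1)) volume volume := by
    intro C hC
    refine (MeasurePreserving.id volume).skew_product (g := fun q p => p + h • C q) ?_ ?_
    · exact Continuous.measurable (by fun_prop)
    · exact ae_of_all _ fun q => map_add_right_eq_self volume (h • C q)
  have sw : MeasurePreserving (Prod.swap : E d × E d → E d × E d) volume volume :=
    Measure.measurePreserving_swap
  exact (shear hB).comp (sw.comp ((shear hA).comp sw))

/-- The pointwise limit of measure preserving maps does not increase the measure of sets. -/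
theorem map_le_of_tendsto_of_measurePreserving {X : Type*} [TopologicalSpace X]
    [MeasurableSpace X] [BorelSpace X] {μ : Measure X} [μ.OuterRegular] {S : ℕ → X → X} {G : X → X}
    (hS : ∀ n, MeasurePreserving (S n) μ μ) (hG : Measurable G)
    (h : ∀ x, Tendsto (fun n => S n x) atTop (𝓝 (G x))) : μ.map G ≤ μ := by
  have hopen : ∀ O : Set X, IsOpen O → μ (G ⁻¹' O) ≤ μ O := by
    intro O hO
    calc μ (G ⁻¹' O) = ∫⁻ x, (G ⁻¹' O).indicator 1 x ∂μ := by
          rw [lintegral_indicator_one (hG hO.measurableSet)]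
      -- A point that `G` sends into the open set `O` is eventually sent there by `S n`; Fatou then
      -- applies, and outer regularity extends the bound from open sets to all measurable ones.
      _ ≤ ∫⁻ x, liminf (fun n => (S n ⁻¹' O).indicator (1 : X → ENNReal) x) atTop ∂μ := by
          refine lintegral_mono fun x => ?_
          by_cases hx : x ∈ G ⁻¹' O
          · rw [indicator_of_mem hx]
            refine le_liminf_of_le (by isBoundedDefault) ?_
            filter_upwards [h x (hO.mem_nhds hx)] with n hn
            rw [indicator_of_mem (show x ∈ S n ⁻¹' O from hn)]
          · rw [indicator_of_notMem hx]; exact zero_le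
      _ ≤ liminf (fun n => ∫⁻ x, (S n ⁻¹' O).indicator (1 : X → ENNReal) x ∂μ) atTop :=
          lintegral_liminf_le fun n =>
            measurable_one.indicator ((hS n).measurable hO.measurableSet)
      _ = μ O := by
          have : ∀ n, ∫⁻ x, (S n ⁻¹' O).indicator (1 : X → ENNReal) x ∂μ = μ O := fun n => by
            rw [lintegral_indicator_one ((hS n).measurable hO.measurableSet),
              (hS n).measure_preimage hO.measurableSet.nullMeasurableSet]
          simp only [this, liminf_const]
  refine Measure.le_iff.2 fun s hs => ?_
  rw [Measure.map_apply hG hs, s.measure_eq_iInf_isOpen μ]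
  refine le_iInf₂ fun O hsO => le_iInf fun hO => ?_
  exact (measure_mono (preimage_mono hsO)).trans (hopen O hO)

/-- **Liouville's theorem** for separable systems. -/
theorem IsSeparableFlow.measurePreserving (h : IsSeparableFlow K A B Φ) (t : ℝ) :
    MeasurePreserving (Φ t) volume volume := by
  have aux : ∀ {A' B' : E d → E d} {Ψ : ℝ → E d × E d → E d × E d}, IsSeparableFlow K A' B' Ψ →
      ∀ s, 0 ≤ s → (volume : Measure (E d × E d)).map (Ψ s) ≤ volume := fun hΨ s hs =>
    map_le_of_tendsto_of_measurePreserving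
      (fun n => (measurePreserving_eulerStep hΨ.lipschitz_left.continuous
        hΨ.lipschitz_right.continuous (s / n)).iterate n)
      (hΨ.continuous_space s).measurable (fun z => hΨ.tendsto_eulerStep_iterate hs z)
  have all : ∀ s, (volume : Measure (E d × E d)).map (Φ s) ≤ volume := fun s => by
    rcases le_total 0 s with hs | hs
    · exact aux h s hs
    · simpa using aux h.reverse (-s) (by linarith)
  have hm : ∀ s, Measurable (Φ s) := fun s => (h.continuous_space s).measurable
  refine ⟨hm t, le_antisymm (all t) ?_⟩
  -- The reverse inequality comes from the inequality at time `-t`, pushed forward by the inverse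
  -- map.
  have e : (volume : Measure (E d × E d)) = (volume.map (Φ (-t))).map (Φ t) := by
    rw [Measure.map_map (hm _) (hm _)]
    have : Φ t ∘ Φ (-t) = id := by ext1 z; simp [← h.add, h.zero]
    rw [this, Measure.map_id]
  conv_lhs => rw [e]
  exact Measure.map_mono (all (-t)) (hm t)

end Liouville

/-! ### Time averages of operators. -/

section Averages

open Set Filter Topology

variable {d : ℕ} {H : ℝ → E d →L[ℝ] E d}

theorem inner_average_apply (hH : Continuous H) (t : ℝ) (v w : E d) :
    inner ℝ ((t⁻¹ • ∫ s in (0 : ℝ)..t, H s) v) w = t⁻¹ * ∫ s in (0 : ℝ)..t, inner ℝ (H s v) w := by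
  rw [smul_apply, real_inner_smul_left,
    ContinuousLinearMap.intervalIntegral_apply (hH.intervalIntegrable _ _), real_inner_comm]
  have h := ((innerSL ℝ w).intervalIntegral_comp_comm (μ := volume)
    ((hH.clm_apply continuous_const).intervalIntegrable (0 : ℝ) t) :
      ∫ s in (0 : ℝ)..t, innerSL ℝ w (H s v) = _)
  simp only [innerSL_apply_apply] at h
  rw [← h]
  simp only [real_inner_comm w]

theorem le_inner_average (hH : Continuous H) {m t : ℝ} (ht : 0 < t) {v : E d}
    (h : ∀ s, m ≤ inner ℝ (H s v) v) : m ≤ inner ℝ ((t⁻¹ • ∫ s in (0 : ℝ)..t, H s) v) v := by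
  rw [inner_average_apply hH, le_inv_mul_iff₀ ht]
  have := intervalIntegral.integral_mono_on (μ := volume) (a := 0) (b := t) (f := fun _ => m)
    (g := fun s => inner ℝ (H s v) v) ht.le (continuous_const.intervalIntegrable _ _)
    (((hH.clm_apply continuous_const).inner continuous_const).intervalIntegrable _ _)
    fun s _ => h s
  simpa using this

theorem isPositive_average (hH : Continuous H) {t : ℝ} (ht : 0 < t) (h : ∀ s, (H s).IsPositive) :
    (t⁻¹ • ∫ s in (0 : ℝ)..t, H s).IsPositive := by
  rw [ContinuousLinearMap.isPositive_iff]
  refine ⟨fun v w => ?_, fun v => ?_⟩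
  · change inner ℝ ((t⁻¹ • ∫ s in (0 : ℝ)..t, H s) v) w =
      inner ℝ v ((t⁻¹ • ∫ s in (0 : ℝ)..t, H s) w)
    rw [real_inner_comm _ v, inner_average_apply hH, inner_average_apply hH]
    have : ∀ s, inner ℝ (H s v) w = inner ℝ (H s w) v := fun s => by
      rw [real_inner_comm v]; exact (h s).isSymmetric v w
    simp only [this]
  · exact le_inner_average hH ht fun s => ((ContinuousLinearMap.isPositive_iff _).1 (h s)).2 v

theorem tendsto_average (hH : Continuous H) :
    Tendsto (fun t : ℝ => t⁻¹ • ∫ s in (0 : ℝ)..t, H s) (𝓝[>] 0) (𝓝 (H 0)) := by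
  have h := intervalIntegral.integral_hasDerivAt_right (hH.intervalIntegrable 0 0)
    (hH.stronglyMeasurableAtFilter _ _) hH.continuousAt
  have h2 := (hasDerivAt_iff_tendsto_slope.1 h).mono_left
    (nhdsWithin_mono (0 : ℝ) (fun x (hx : 0 < x) => (ne_of_gt hx : x ∈ ({0} : Set ℝ)ᶜ)))
  refine h2.congr fun t => ?_
  simp [slope]

theorem tendsto_clm_comp {ι : Type*} {l : Filter ι} {f g : ι → E d →L[ℝ] E d}
    {a b : E d →L[ℝ] E d} (hf : Tendsto f l (𝓝 a)) (hg : Tendsto g l (𝓝 b)) :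
    Tendsto (fun i => f i ∘L g i) l (𝓝 (a ∘L b)) := by
  have hc : Continuous fun z : (E d →L[ℝ] E d) × (E d →L[ℝ] E d) => z.1 ∘L z.2 :=
    continuous_fst.clm_comp continuous_snd
  exact (hc.tendsto (a, b)).comp (hf.prodMk_nhds hg)

end Averages

/-! ### Nondegeneracy of the Hamiltonian flow before the conjugate time. -/

section HamiltonianFlow

open Set Filter Topology

variable {d : ℕ} {m M : ℝ} {U V : E d → ℝ} {Φ : ℝ → E d × E d → E d × E d}

theorem IsHamiltonianFlow.isSeparableFlow (hΦ : IsHamiltonianFlow U V Φ)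
    (hU : IsUniformlyConvex m M U) (hV : IsUniformlyConvex m M V) :
    IsSeparableFlow M.toNNReal (gradient V) (fun q => -gradient U q) Φ where
  lipschitz_left := LipschitzWith.of_dist_le_mul fun x y => by
    rw [dist_eq_norm, dist_eq_norm, Real.coe_toNNReal _ hV.pos'.le]
    exact hV.norm_gradient_sub_le x y
  lipschitz_right := LipschitzWith.neg <| LipschitzWith.of_dist_le_mul fun x y => by
    rw [dist_eq_norm, dist_eq_norm, Real.coe_toNNReal _ hU.pos'.le]
    exact hU.norm_gradient_sub_le x y
  zero z := (hΦ z).1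
  deriv z t := (hΦ z).2 t

/-- A uniform bound on `√(V̄ Ū)` bounds the products of the Hessians at any two points. -/
theorem norm_hess_comp_hess_le (hΦ : IsHamiltonianFlow U V Φ)
    (hU : IsUniformlyConvex m M U) (hV : IsUniformlyConvex m M V) {T a : ℝ} (hT : 0 < T)
    (h : ∀ z, ∀ t ∈ Ioc 0 T, ‖opA U V Φ t z‖ ≤ a) (p q : E d) :
    ‖hess V p ∘L hess U q‖ ≤ a ^ 2 := by
  have hflow := hΦ.isSeparableFlow hU hV
  set z : E d × E d := (q, p)
  have hcV : Continuous fun s => hess V (Φ s z).2 :=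
    hV.continuous_hess.comp (continuous_snd.comp (hflow.continuous_time z))
  have hcU : Continuous fun s => hess U (Φ s z).1 :=
    hU.continuous_hess.comp (continuous_fst.comp (hflow.continuous_time z))
  have tV : Tendsto (fun t => avgV V Φ t z) (𝓝[>] 0) (𝓝 (hess V p)) := by
    simpa [avgV, hflow.zero] using tendsto_average hcV
  have tU : Tendsto (fun t => avgU U Φ t z) (𝓝[>] 0) (𝓝 (hess U q)) := by
    simpa [avgU, hflow.zero] using tendsto_average hcU
  have tc : Tendsto (fun t => avgV V Φ t z ∘L avgU U Φ t z) (𝓝[>] 0)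
      (𝓝 (hess V p ∘L hess U q)) := tendsto_clm_comp tV tU
  refine le_of_tendsto tc.norm ?_
  -- For each positive `t` up to `T` the product of the averages is the square of `opA`, of norm at
  -- most `a ^ 2`; the limit at zero keeps the bound.
  filter_upwards [Ioc_mem_nhdsGT hT] with t ht
  have e := sqrtMul_comp_self (V := avgV V Φ t z) (U := avgU U Φ t z)
    (isPositive_average hcV ht.1 fun s => hV.isPositive_hess _)
    (isPositive_average hcU ht.1 fun s => hU.isPositive_hess _) hU.pos
    (fun v => by
      rw [real_inner_comm]
      exact le_inner_average hcU ht.1 fun s => by rw [real_inner_comm]; exact hU.le_hess _ v)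
  rw [← e, sq]
  exact (ContinuousLinearMap.opNorm_comp_le _ _).trans
    (mul_self_le_mul_self (norm_nonneg _) (h z t ht))

/-- A real number strictly between |A| and π/T; strictness makes it positive even if |A| = 0. The
case |A| = ∞ is excluded because then the right side of the hypothesis is zero. -/
theorem exists_forall_norm_opA_le {T : ℝ} (hT0 : 0 < T)
    (hT : ENNReal.ofReal T < ENNReal.ofReal Real.pi / normA U V Φ T) :
    ∃ a : ℝ, 0 < a ∧ a * T < Real.pi ∧ ∀ z, ∀ t ∈ Ioc 0 T, ‖opA U V Φ t z‖ ≤ a := by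
  have hT' : ENNReal.ofReal T ≠ 0 := by simpa using hT0
  have h1 : normA U V Φ T < ENNReal.ofReal (Real.pi / T) := by
    rw [ENNReal.ofReal_div_of_pos hT0,
      ENNReal.lt_div_iff_mul_lt (Or.inl hT') (Or.inl ENNReal.ofReal_ne_top), mul_comm]
    rwa [← ENNReal.lt_div_iff_mul_lt (Or.inr ENNReal.ofReal_ne_top) (Or.inr hT')]
  obtain ⟨a, ha1, ha2⟩ := ENNReal.lt_iff_exists_nnreal_btwn.1 h1
  have ha : 0 < a := by
    have : (0 : ENNReal) < a := bot_le.trans_lt ha1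
    exact_mod_cast this
  refine ⟨a, by exact_mod_cast ha, ?_, fun z t ht => ?_⟩
  · rw [← lt_div_iff₀ hT0]
    rw [ENNReal.ofReal, ENNReal.coe_lt_coe, ← NNReal.coe_lt_coe,
      Real.coe_toNNReal _ (by positivity)] at ha2
    exact ha2
  · have : ‖opA U V Φ t z‖ₑ ≤ normA U V Φ T :=
      le_iSup_of_le z (le_iSup₂_of_le t ht le_rfl)
    have := this.trans ha1.le
    exact_mod_cast enorm_le_coe.1 this

theorem dist_prodMk_left {X Y : Type*} [PseudoMetricSpace X] [PseudoMetricSpace Y] (x : X)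
    (y₁ y₂ : Y) : dist (x, y₁) (x, y₂) = dist y₁ y₂ := by
  simp [Prod.dist_eq]

theorem dist_prodMk_right {X Y : Type*} [PseudoMetricSpace X] [PseudoMetricSpace Y] (x₁ x₂ : X)
    (y : Y) : dist (x₁, y) (x₂, y) = dist x₁ x₂ := by
  simp [Prod.dist_eq]

namespace IsHamiltonianFlow

theorem norm_sub_le (hΦ : IsHamiltonianFlow U V Φ) (hU : IsUniformlyConvex m M U)
    (hV : IsUniformlyConvex m M V) {T s : ℝ} (hs : s ∈ Icc 0 T) (z w : E d × E d) :
    ‖Φ s z - Φ s w‖ ≤ Real.exp (M * T) * dist z w := by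
  have := (hΦ.isSeparableFlow hU hV).dist_le hs.1 z w
  rw [Real.coe_toNNReal _ hU.pos'.le] at this
  rw [← dist_eq_norm, mul_comm]
  refine this.trans ?_
  have := hU.pos'
  gcongr
  exact hs.2

theorem isVariation_position (hΦ : IsHamiltonianFlow U V Φ) (hU : IsUniformlyConvex m M U)
    (hV : IsUniformlyConvex m M V) (T : ℝ) (q p₁ p₂ : E d) :
    IsVariation m M (Real.exp (M * T)) T
      (fun s => (Φ s (q, p₁)).1 - (Φ s (q, p₂)).1) (fun s => (Φ s (q, p₁)).2 - (Φ s (q, p₂)).2)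
      (fun s => gradient V (Φ s (q, p₁)).2 - gradient V (Φ s (q, p₂)).2)
      (fun s => -gradient U (Φ s (q, p₁)).1 - -gradient U (Φ s (q, p₂)).1) := by
  have hf := hΦ.isSeparableFlow hU hV
  constructor
  · exact fun s => (hf.hasDerivAt_fst _ s).sub (hf.hasDerivAt_fst _ s)
  · exact fun s => (hf.hasDerivAt_snd _ s).sub (hf.hasDerivAt_snd _ s)
  · simp [hf.zero]
  · exact fun s => hV.le_inner_gradient_sub _ _
  · exact fun s => hV.norm_gradient_sub_le _ _
  · intro s
    rw [neg_sub_neg, norm_sub_rev]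
    exact hU.norm_gradient_sub_le _ _
  · intro s hs
    simp only [hf.zero]
    rw [← dist_eq_norm p₁, ← dist_prodMk_left q]
    exact (norm_fst_le (Φ s (q, p₁) - Φ s (q, p₂))).trans (hΦ.norm_sub_le hU hV hs _ _)
  · intro s hs
    simp only [hf.zero]
    rw [← dist_eq_norm p₁, ← dist_prodMk_left q]
    exact (norm_snd_le (Φ s (q, p₁) - Φ s (q, p₂))).trans (hΦ.norm_sub_le hU hV hs _ _)

/-- The system is symmetric under the exchange of (Q, U) with (P, V) up to a sign, which is why the
order of the two trajectories is reversed in the position difference. -/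
theorem isVariation_momentum (hΦ : IsHamiltonianFlow U V Φ) (hU : IsUniformlyConvex m M U)
    (hV : IsUniformlyConvex m M V) (T : ℝ) (p q₁ q₂ : E d) :
    IsVariation m M (Real.exp (M * T)) T
      (fun s => (Φ s (q₁, p)).2 - (Φ s (q₂, p)).2) (fun s => (Φ s (q₂, p)).1 - (Φ s (q₁, p)).1)
      (fun s => gradient U (Φ s (q₂, p)).1 - gradient U (Φ s (q₁, p)).1)
      (fun s => gradient V (Φ s (q₂, p)).2 - gradient V (Φ s (q₁, p)).2) := by
  have hf := hΦ.isSeparableFlow hU hV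
  constructor
  · intro s
    have := (hf.hasDerivAt_snd (q₁, p) s).sub (hf.hasDerivAt_snd (q₂, p) s)
    rw [neg_sub_neg] at this
    exact this
  · exact fun s => (hf.hasDerivAt_fst _ s).sub (hf.hasDerivAt_fst _ s)
  · simp [hf.zero]
  · exact fun s => hU.le_inner_gradient_sub _ _
  · exact fun s => hU.norm_gradient_sub_le _ _
  · intro s
    rw [norm_sub_rev (Φ s (q₁, p)).2]
    exact hV.norm_gradient_sub_le _ _
  · intro s hs
    simp only [hf.zero]
    rw [norm_sub_rev q₂, ← dist_eq_norm q₁, ← dist_prodMk_right q₁ q₂ p]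
    exact (norm_snd_le (Φ s (q₁, p) - Φ s (q₂, p))).trans (hΦ.norm_sub_le hU hV hs _ _)
  · intro s hs
    simp only [hf.zero]
    rw [← dist_eq_norm q₂, ← dist_prodMk_right q₂ q₁ p]
    exact (norm_fst_le (Φ s (q₂, p) - Φ s (q₁, p))).trans (hΦ.norm_sub_le hU hV hs _ _)

theorem continuous_gradient_fst (hΦ : IsHamiltonianFlow U V Φ) (hU : IsUniformlyConvex m M U)
    (hV : IsUniformlyConvex m M V) (z : E d × E d) :
    Continuous fun s => gradient U (Φ s z).1 :=
  hU.contDiff_gradient.continuous.comp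
    (continuous_fst.comp ((hΦ.isSeparableFlow hU hV).continuous_time z))

theorem continuous_gradient_snd (hΦ : IsHamiltonianFlow U V Φ) (hU : IsUniformlyConvex m M U)
    (hV : IsUniformlyConvex m M V) (z : E d × E d) :
    Continuous fun s => gradient V (Φ s z).2 :=
  hV.contDiff_gradient.continuous.comp
    (continuous_snd.comp ((hΦ.isSeparableFlow hU hV).continuous_time z))

/-- The position at time `t` determines the initial momentum, in a Lipschitz way. -/
theorem exists_le_norm_position_sub (hΦ : IsHamiltonianFlow U V Φ) (hU : IsUniformlyConvex m M U)
    (hV : IsUniformlyConvex m M V) {a T t₀ : ℝ} (ha : 0 < a) (haT : a * T < Real.pi)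
    (hpair : ∀ p q, ‖hess V p ∘L hess U q‖ ≤ a ^ 2) (ht₀ : 0 < t₀) (ht₀T : t₀ ≤ T) :
    ∃ c, 0 < c ∧ ∀ t ∈ Icc t₀ T, ∀ q p₁ p₂ : E d,
      c * ‖p₁ - p₂‖ ≤ ‖(Φ t (q, p₁)).1 - (Φ t (q, p₂)).1‖ := by
  have hf := hΦ.isSeparableFlow hU hV
  obtain ⟨c, hc, h⟩ := exists_le_norm_of_isVariation (F := E d) hU.pos hU.pos'
    (Real.exp_pos (M * T)) (Real.sqrt_nonneg M) ha haT ht₀ ht₀T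
  refine ⟨c, hc, fun t ht q p₁ p₂ => ?_⟩
  have := h (IsUniformlyConvex.hessSeminorm U) hU.hessSeminorm_le _ _ _ _
    (hΦ.isVariation_position hU hV T q p₁ p₂)
    ((hΦ.continuous_gradient_snd hU hV _).sub (hΦ.continuous_gradient_snd hU hV _))
    ((hΦ.continuous_gradient_fst hU hV _).neg.sub (hΦ.continuous_gradient_fst hU hV _).neg)
    (fun s => hU.hessSeminorm_gradient_sub_sq_le hV hpair _ _)
    (fun s => by
      rw [neg_sub_neg, ← inner_neg_right, neg_sub, real_inner_comm]
      exact hU.inner_gradient_sub_le_hessSeminorm_sq _ _) t ht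
  simpa [hf.zero] using this

/-- The momentum at time `t` determines the initial position, in a Lipschitz way. -/
theorem exists_le_norm_momentum_sub (hΦ : IsHamiltonianFlow U V Φ) (hU : IsUniformlyConvex m M U)
    (hV : IsUniformlyConvex m M V) {a T t₀ : ℝ} (ha : 0 < a) (haT : a * T < Real.pi)
    (hpair : ∀ p q, ‖hess V p ∘L hess U q‖ ≤ a ^ 2) (ht₀ : 0 < t₀) (ht₀T : t₀ ≤ T) :
    ∃ c, 0 < c ∧ ∀ t ∈ Icc t₀ T, ∀ p q₁ q₂ : E d,
      c * ‖q₁ - q₂‖ ≤ ‖(Φ t (q₁, p)).2 - (Φ t (q₂, p)).2‖ := by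
  have hf := hΦ.isSeparableFlow hU hV
  obtain ⟨c, hc, h⟩ := exists_le_norm_of_isVariation (F := E d) hU.pos hU.pos'
    (Real.exp_pos (M * T)) (Real.sqrt_nonneg M) ha haT ht₀ ht₀T
  refine ⟨c, hc, fun t ht p q₁ q₂ => ?_⟩
  have := h (IsUniformlyConvex.hessSeminorm V) hV.hessSeminorm_le _ _ _ _
    (hΦ.isVariation_momentum hU hV T p q₁ q₂)
    ((hΦ.continuous_gradient_fst hU hV _).sub (hΦ.continuous_gradient_fst hU hV _))
    ((hΦ.continuous_gradient_snd hU hV _).sub (hΦ.continuous_gradient_snd hU hV _))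
    (fun s => hV.hessSeminorm_gradient_sub_sq_le hU (fun p q => by
      rw [norm_comp_comm_of_isPositive (hV.isPositive_hess q) (hU.isPositive_hess p)]
      exact hpair q p) _ _)
    (fun s => by
      rw [← inner_neg_right, neg_sub, real_inner_comm]
      exact hV.inner_gradient_sub_le_hessSeminorm_sq _ _) t ht
  simpa [hf.zero, norm_sub_rev q₂] using this

/-- Any two positions are joined by a motion of duration `t`. -/
theorem surjective_position (hΦ : IsHamiltonianFlow U V Φ) (hU : IsUniformlyConvex m M U)
    (hV : IsUniformlyConvex m M V) {a T : ℝ} (ha : 0 < a) (hT : 0 < T) (haT : a * T < Real.pi)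
    (hpair : ∀ p q, ‖hess V p ∘L hess U q‖ ≤ a ^ 2) (q : E d) :
    Function.Surjective fun p => (Φ T (q, p)).1 := by
  have hf := hΦ.isSeparableFlow hU hV
  have hm := hU.pos
  have hM := hU.pos'
  set L := Real.exp (M * T) with hLd
  have hL : 0 < L := Real.exp_pos _
  have hlip : ∀ t ∈ Icc 0 T, ∀ p₁ p₂,
      ‖(Φ t (q, p₁)).1 - (Φ t (q, p₂)).1‖ ≤ L * ‖p₁ - p₂‖ := fun t ht p₁ p₂ => by
    simpa [hf.zero] using (hΦ.isVariation_position hU hV T q p₁ p₂).norm_x t ht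
  -- Up to this time the map is strongly monotone, hence onto.
  set t₁ := min T (m / (M * L * (4 * (m + M)))) with ht₁
  have ht₁0 : 0 < t₁ := by positivity
  have ht₁T : t₁ ≤ T := min_le_left _ _
  have base : Function.Surjective fun p => (Φ t₁ (q, p)).1 := by
    have hsmall : M * L * t₁ * (4 * (m + M)) ≤ m := by
      have := min_le_right T (m / (M * L * (4 * (m + M))))
      rw [← ht₁, le_div_iff₀ (by positivity)] at this
      linarith
    refine surjective_of_lipschitz_of_monotone hL (c := m / 2 * t₁) (by positivity)
      (hlip t₁ ⟨ht₁0.le, ht₁T⟩) fun p₁ p₂ => ?_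
    simpa [hf.zero] using (hΦ.isVariation_position hU hV T q p₁ p₂).le_inner_zero hm hM hL
      ht₁0.le ht₁T hsmall
  obtain ⟨c, hc, hexp⟩ := hΦ.exists_le_norm_position_sub hU hV ha haT hpair ht₁0 ht₁T
  -- A time step of at most `η` changes the map by something of Lipschitz constant at most `c / 2`,
  -- below the expansion constant `c`. Since `c` serves all of `[t₁, T]`, finitely many equal steps
  -- reach `T`.
  set η := c / (2 * (M * L)) with hη
  have hη0 : 0 < η := by positivity
  have step : ∀ n : ℕ, ∀ t ∈ Icc t₁ T, t ≤ t₁ + n * η →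
      Function.Surjective fun p => (Φ t (q, p)).1 := by
    intro n
    induction n with
    | zero =>
      intro t ht htn
      have : t = t₁ := le_antisymm (by simpa using htn) ht.1
      rw [this]
      exact base
    | succ n ih =>
      intro t ht htn
      set s := max t₁ (t - η) with hs
      have hst : s ≤ t := max_le ht.1 (by linarith)
      have hsI : s ∈ Icc t₁ T := ⟨le_max_left _ _, hst.trans ht.2⟩
      have hts : t - s ≤ η := by have := le_max_right t₁ (t - η); linarith
      have hsn : s ≤ t₁ + n * η := by
        refine max_le (by have : 0 ≤ n * η := by positivity
                          linarith) ?_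
        push_cast at htn
        linarith
      refine surjective_of_lipschitz_sub (G := fun p => (Φ s (q, p)).1) (c := c) (K := c / 2)
        (by positivity) (by linarith) (ih s hsI hsn) (hexp s hsI q) fun p₁ p₂ => ?_
      have hv := hΦ.isVariation_position hU hV T q p₁ p₂
      have h0 := norm_image_sub_le_of_norm_deriv_le_segment'
        (f := fun s => (Φ s (q, p₁)).1 - (Φ s (q, p₂)).1) (a := s) (b := t)
        (C := M * (L * ‖p₁ - p₂‖))
        (fun u _ => (hv.hx u).hasDerivWithinAt) (fun u hu => (hv.norm_x' u).trans (by
          gcongr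
          simpa [hf.zero] using hv.norm_y u
            ⟨ht₁0.le.trans (hsI.1.trans hu.1), hu.2.le.trans ht.2⟩)) t ⟨hst, le_rfl⟩
      rw [sub_sub_sub_comm]
      calc _ ≤ M * (L * ‖p₁ - p₂‖) * (t - s) := h0
        _ ≤ M * (L * ‖p₁ - p₂‖) * η := by gcongr
        _ = c / 2 * ‖p₁ - p₂‖ := by rw [hη]; field_simp
  obtain ⟨n, hn⟩ := exists_nat_ge ((T - t₁) / η)
  refine step n T ⟨ht₁T, le_rfl⟩ ?_
  rw [div_le_iff₀ hη0] at hn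
  linarith

end IsHamiltonianFlow

end HamiltonianFlow

/-! ### Harris' theorem for measure evolutions. -/

section Harris

open Set

variable {X : Type*} [MeasurableSpace X]

/-- A Markov evolution of measures with the Lyapunov function `W` which has a geometric drift and
satisfies a minorization condition on every sublevel set of `W`. -/
structure IsHarrisStep (P : Measure X → Measure X) (W : X → ENNReal) (l K : NNReal) : Prop where
  measurable : Measurable W
  lt_one : l < 1
  add : ∀ (μ ν : Measure X) [IsFiniteMeasure μ] [IsFiniteMeasure ν], P (μ + ν) = P μ + P ν
  measure_univ : ∀ (μ : Measure X) [IsFiniteMeasure μ], P μ univ = μ univ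
  drift : ∀ (μ : Measure X) [IsFiniteMeasure μ],
    ∫⁻ x, W x ∂P μ ≤ l * ∫⁻ x, W x ∂μ + K * μ univ
  minorization : ∀ R : NNReal, ∃ α : NNReal, 0 < α ∧ α ≤ 1 ∧ ∃ ν₀ : Measure X,
    IsProbabilityMeasure ν₀ ∧ ∀ (μ : Measure X) [IsFiniteMeasure μ],
      (α * μ {x | W x ≤ R}) • ν₀ ≤ P μ

/-- The total mass of two measures, weighted by `1 + β W`. -/
def weightedMass (W : X → ENNReal) (β : NNReal) (μ ν : Measure X) : ENNReal :=
  (μ univ + ν univ) + β * (∫⁻ x, W x ∂μ + ∫⁻ x, W x ∂ν)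

/-- Markov's inequality at twice the mean bound: at most half of the mass lies where `W` is larger.
-/
theorem half_mass_le_of_lintegral_le {W : X → ENNReal} (hW : Measurable W) {μ : Measure X}
    [IsFiniteMeasure μ] {R : NNReal} (hR : 0 < R) (h : ∫⁻ x, W x ∂μ ≤ R * μ univ) :
    μ univ / 2 ≤ μ {x | W x ≤ (2 * R : NNReal)} := by
  have h1 := mul_meas_ge_le_lintegral (μ := μ) hW ((2 * R : NNReal) : ENNReal)
  have h2 : μ univ ≤ μ {x | W x ≤ (2 * R : NNReal)} + μ {x | ((2 * R : NNReal) : ENNReal) ≤ W x} := by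
    refine (measure_mono fun x _ => ?_).trans (measure_union_le _ _)
    exact le_total (W x) _
  have h3 := h1.trans h
  have f1 : μ univ ≠ ⊤ := measure_ne_top _ _
  have f2 : μ {x | W x ≤ (2 * R : NNReal)} ≠ ⊤ := measure_ne_top _ _
  have f3 : μ {x | ((2 * R : NNReal) : ENNReal) ≤ W x} ≠ ⊤ := measure_ne_top _ _
  refine ENNReal.div_le_of_le_mul ?_
  lift μ univ to NNReal using f1 with m
  lift μ {x | W x ≤ (2 * R : NNReal)} to NNReal using f2 with a
  lift μ {x | ((2 * R : NNReal) : ENNReal) ≤ W x} to NNReal using f3 with b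
  norm_cast at h2 h3 ⊢
  rw [← NNReal.coe_le_coe] at *
  push_cast at *
  have hR' : (0 : ℝ) < R := hR
  have : (b : ℝ) * 2 ≤ m := le_of_mul_le_mul_left (by linarith) hR'
  linarith

theorem exists_split_of_minorization {P : Measure X → Measure X} {W : X → ENNReal}
    {μ ν₀ : Measure X} {c : ENNReal} [IsFiniteMeasure (P μ)] [IsProbabilityMeasure ν₀]
    (h : c • ν₀ ≤ P μ) : ∃ μ' : Measure X, IsFiniteMeasure μ' ∧ P μ = c • ν₀ + μ' ∧
      μ' univ + c = P μ univ ∧ ∫⁻ x, W x ∂μ' ≤ ∫⁻ x, W x ∂P μ := by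
  have : IsFiniteMeasure (c • ν₀) := isFiniteMeasure_of_le _ h
  have e : P μ - c • ν₀ + c • ν₀ = P μ := Measure.sub_add_cancel_of_le h
  refine ⟨P μ - c • ν₀, inferInstance, by rw [add_comm, e], ?_,
    lintegral_mono' Measure.sub_le le_rfl⟩
  conv_rhs => rw [← e]
  simp

/-- Here `m` stands for the mass of each measure and `w` for the sum of the two integrals of W. If
`w` is large against `m`, the drift alone contracts. In general a loss `α * m` of mass pays for the
additive drift constant, once `β` is so small that `4 * β * K ≤ α`. -/
theorem exists_contraction_constants {l K α R : ℝ} (hl : l < 1) (hK : 0 ≤ K)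
    (hα : 0 < α) (hα1 : α ≤ 1) (hR : 0 < R) (hRK : 4 * K ≤ (1 - l) * R) :
    ∃ β ρ : ℝ, 0 < β ∧ 0 < ρ ∧ ρ < 1 ∧
      (∀ m w, 0 ≤ m → 0 ≤ w → R * m ≤ w → 2 * m + β * (l * w + 2 * K * m) ≤ ρ * (2 * m + β * w)) ∧
      ∀ m w, 0 ≤ m → 0 ≤ w →
        2 * m - α * m + β * (l * w + 2 * K * m) ≤ ρ * (2 * m + β * w) := by
  set β := α / (4 * (K + 1)) with hβ
  have hβ0 : 0 < β := by positivity
  have hβK : 4 * (β * K) ≤ α := by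
    have : β * (4 * (K + 1)) = α := by rw [hβ]; field_simp
    nlinarith
  have hl' : 0 < 1 - l := by linarith
  set ε := min (α / 4) (min ((1 - l) / 4) (β * R * (1 - l) / 8)) with hε
  have hε0 : 0 < ε := by positivity
  have e1 : ε ≤ α / 4 := min_le_left _ _
  have e2 : ε ≤ (1 - l) / 4 := (min_le_right _ _).trans (min_le_left _ _)
  have e3 : ε ≤ β * R * (1 - l) / 8 := (min_le_right _ _).trans (min_le_right _ _)
  refine ⟨β, 1 - ε, hβ0, by linarith, by linarith, ?_, ?_⟩
  · intro m w hm hw h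
    have a1 : 4 * K * m ≤ (1 - l) * w := by nlinarith
    have a2 : 2 * ε * m ≤ β * (1 - l) / 4 * w := by
      have : ε * m ≤ β * R * (1 - l) / 8 * m := by gcongr
      have : β * (1 - l) / 8 * (R * m) ≤ β * (1 - l) / 8 * w := by gcongr
      linarith
    have a3 : ε * (β * w) ≤ (1 - l) / 4 * (β * w) := by gcongr
    nlinarith
  · intro m w hm hw
    have a1 : ε * m ≤ α / 4 * m := by gcongr
    have a2 : ε * (β * w) ≤ (1 - l) / 4 * (β * w) := by gcongr
    have a3 : 4 * (β * K) * m ≤ α * m := by gcongr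
    have a4 : 0 ≤ (1 - l) * (β * w) := by positivity
    nlinarith

variable {P : Measure X → Measure X} {W : X → ENNReal} {l K : NNReal}

theorem IsHarrisStep.isFiniteMeasure (h : IsHarrisStep P W l K) (μ : Measure X)
    [IsFiniteMeasure μ] : IsFiniteMeasure (P μ) :=
  ⟨by rw [h.measure_univ]; exact measure_lt_top _ _⟩

/-- Two measures of the same mass lose, in one step, a fixed fraction of their weighted mass to a
common part. -/
theorem IsHarrisStep.exists_contraction (h : IsHarrisStep P W l K) :
    ∃ β ρ : NNReal, 0 < β ∧ 0 < ρ ∧ ρ < 1 ∧ ∀ (μ ν : Measure X) [IsFiniteMeasure μ]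
      [IsFiniteMeasure ν], μ univ = ν univ → ∃ κ μ' ν' : Measure X, IsFiniteMeasure κ ∧
        IsFiniteMeasure μ' ∧ IsFiniteMeasure ν' ∧ P μ = κ + μ' ∧ P ν = κ + ν' ∧
        μ' univ = ν' univ ∧ weightedMass W β μ' ν' ≤ ρ * weightedMass W β μ ν := by
  have hl : (0 : ℝ) < 1 - l := sub_pos.2 (by exact_mod_cast h.lt_one)
  -- The threshold at which the drift gain beats the constant `K`; the added one keeps it positive
  -- if `K = 0`.
  set R : NNReal := ⟨4 * K / (1 - l) + 1, by positivity⟩ with hRd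
  have hR : 0 < R := by
    rw [← NNReal.coe_pos]
    change (0 : ℝ) < 4 * K / (1 - l) + 1
    positivity
  have hRK : 4 * (K : ℝ) ≤ (1 - l) * R := by
    change 4 * (K : ℝ) ≤ (1 - l) * (4 * K / (1 - l) + 1)
    rw [mul_add, mul_div_cancel₀ _ hl.ne']
    linarith
  obtain ⟨α, hα, hα1, ν₀, hν₀, hmin⟩ := h.minorization (2 * R)
  obtain ⟨β, ρ, hβ, hρ, hρ1, c1, c2⟩ := exists_contraction_constants (l := l) (R := R) (α := α) (by exact_mod_cast h.lt_one)
    K.coe_nonneg (by exact_mod_cast hα) (by exact_mod_cast hα1) (by exact_mod_cast hR) hRK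
  lift β to NNReal using hβ.le
  lift ρ to NNReal using hρ.le
  refine ⟨β, ρ, by exact_mod_cast hβ, by exact_mod_cast hρ, by exact_mod_cast hρ1, ?_⟩
  intro μ ν _ _ hμν
  have := h.isFiniteMeasure μ
  have := h.isFiniteMeasure ν
  have d1 := h.drift μ
  have d2 := h.drift ν
  have u1 := h.measure_univ μ
  have u2 := h.measure_univ ν
  -- If an integral is infinite, so is the weighted mass, and the bound is void because `β` and `ρ`
  -- are nonzero.
  by_cases hw : ∫⁻ x, W x ∂μ + ∫⁻ x, W x ∂ν = ⊤
  · refine ⟨0, P μ, P ν, inferInstance, inferInstance, inferInstance, (zero_add _).symm,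
      (zero_add _).symm, by rw [u1, u2, hμν], ?_⟩
    have : weightedMass W β μ ν = ⊤ := by
      rw [weightedMass, hw, ENNReal.mul_top (by exact_mod_cast hβ.ne'), add_top]
    rw [this, ENNReal.mul_top (by exact_mod_cast hρ.ne')]
    exact le_top
  obtain ⟨hw1, hw2⟩ := ENNReal.add_ne_top.1 hw
  by_cases hc : R * μ univ ≤ ∫⁻ x, W x ∂μ + ∫⁻ x, W x ∂ν
  · refine ⟨0, P μ, P ν, inferInstance, inferInstance, inferInstance, (zero_add _).symm,
      (zero_add _).symm, by rw [u1, u2, hμν], ?_⟩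
    rw [weightedMass, weightedMass, u1, u2]
    refine (add_le_add_right (mul_le_mul_right (add_le_add d1 d2) _) _).trans ?_
    rw [← hμν]
    have hm : μ univ ≠ ⊤ := measure_ne_top _ _
    lift μ univ to NNReal using hm with m
    lift ∫⁻ x, W x ∂μ to NNReal using hw1 with w₁
    lift ∫⁻ x, W x ∂ν to NNReal using hw2 with w₂
    norm_cast at hc ⊢
    rw [← NNReal.coe_le_coe] at hc ⊢
    push_cast at hc ⊢
    have := c1 m (w₁ + w₂) m.coe_nonneg (by positivity) hc
    nlinarith
  · rw [not_le] at hc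
    have t1 := half_mass_le_of_lintegral_le (μ := μ) h.measurable hR (le_self_add.trans hc.le)
    have t2 := half_mass_le_of_lintegral_le (μ := ν) h.measurable hR
      (le_add_self.trans (hμν ▸ hc.le))
    rw [← hμν] at t2
    -- Both measures have at least half of their mass in the sublevel set, so both images contain `c
    -- • ν₀`; removing it costs `α * μ univ` of mass in total.
    set c : ENNReal := α * (μ univ / 2) with hcd
    have k1 : c • ν₀ ≤ P μ := le_trans (by rw [hcd]; gcongr) (hmin μ)
    have k2 : c • ν₀ ≤ P ν := le_trans (by rw [hcd]; gcongr) (hmin ν)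
    obtain ⟨μ', fμ, eμ, mμ, wμ⟩ := exists_split_of_minorization (W := W) k1
    obtain ⟨ν', fν, eν, mν, wν⟩ := exists_split_of_minorization (W := W) k2
    have hcf : IsFiniteMeasure (c • ν₀) := isFiniteMeasure_of_le _ k1
    have hct : c ≠ ⊤ := by
      rw [hcd]
      exact ENNReal.mul_ne_top ENNReal.coe_ne_top
        (ENNReal.div_ne_top (measure_ne_top _ _) two_ne_zero)
    have hm' : μ' univ = ν' univ := by
      rw [u1] at mμ
      rw [u2, ← hμν, ← mμ] at mν
      exact ((ENNReal.add_left_inj hct).1 mν).symm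
    refine ⟨c • ν₀, μ', ν', hcf, fμ, fν, eμ, eν, hm', ?_⟩
    rw [weightedMass, weightedMass]
    refine (add_le_add_right (mul_le_mul_right (add_le_add (wμ.trans d1) (wν.trans d2)) _) _).trans ?_
    rw [← hm', ← hμν]
    rw [u1] at mμ
    have hm : μ univ ≠ ⊤ := measure_ne_top _ _
    have hm2 : μ' univ ≠ ⊤ := measure_ne_top _ _
    have hc2 : c * 2 = α * μ univ := by
      rw [hcd, mul_assoc, ENNReal.div_mul_cancel two_ne_zero ENNReal.ofNat_ne_top]
    clear_value c
    lift μ univ to NNReal using hm with m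
    lift μ' univ to NNReal using hm2 with m'
    lift c to NNReal using hct
    lift ∫⁻ x, W x ∂μ to NNReal using hw1 with w₁
    lift ∫⁻ x, W x ∂ν to NNReal using hw2 with w₂
    norm_cast at mμ hc2 ⊢
    rw [← NNReal.coe_le_coe]
    rw [← NNReal.coe_inj] at mμ hc2
    push_cast at mμ hc2 ⊢
    have := c2 m (w₁ + w₂) m.coe_nonneg (by positivity)
    nlinarith

/-- Harris' theorem: the parts of two evolutions which are not common decay geometrically. -/
theorem IsHarrisStep.exists_iterate_split (h : IsHarrisStep P W l K) :
    ∃ β ρ : NNReal, 0 < β ∧ 0 < ρ ∧ ρ < 1 ∧ ∀ (μ ν : Measure X) [IsFiniteMeasure μ]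
      [IsFiniteMeasure ν], μ univ = ν univ → ∀ n : ℕ, ∃ κ μ' ν' : Measure X, IsFiniteMeasure κ ∧
        IsFiniteMeasure μ' ∧ IsFiniteMeasure ν' ∧ P^[n] μ = κ + μ' ∧ P^[n] ν = κ + ν' ∧
        μ' univ = ν' univ ∧ weightedMass W β μ' ν' ≤ ρ ^ n * weightedMass W β μ ν := by
  obtain ⟨β, ρ, hβ, hρ, hρ1, hstep⟩ := h.exists_contraction
  refine ⟨β, ρ, hβ, hρ, hρ1, ?_⟩
  intro μ ν _ _ hμν n
  induction n with
  | zero =>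
    exact ⟨0, μ, ν, inferInstance, inferInstance, inferInstance, by simp, by simp, hμν, by simp⟩
  | succ n ih =>
    obtain ⟨κ, μ', ν', _, _, _, eμ, eν, hm, hw⟩ := ih
    -- The common part evolves identically on both sides; only the remainders are compared again.
    obtain ⟨κ', μ'', ν'', _, fμ, fν, eμ', eν', hm', hw'⟩ := hstep μ' ν' hm
    have := h.isFiniteMeasure κ
    refine ⟨P κ + κ', μ'', ν'', inferInstance, fμ, fν, ?_, ?_, hm', ?_⟩
    · rw [Function.iterate_succ_apply', eμ, h.add, eμ', add_assoc]
    · rw [Function.iterate_succ_apply', eν, h.add, eν', add_assoc]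
    · refine hw'.trans ?_
      rw [pow_succ', mul_assoc]
      gcongr

end Harris

/-! ### From split measures to the Wasserstein distance. -/

section Wasserstein

open Set

variable {d : ℕ}

/-- The common part is coupled with itself on the diagonal at no cost, and the remainders
independently, with |x - y| ≤ |x| + |y|. -/
theorem W1_le_of_split {μ ν κ μ' ν' : Measure (E d)} [IsFiniteMeasure κ] [IsFiniteMeasure μ']
    [IsFiniteMeasure ν'] (hμ : μ = κ + μ') (hν : ν = κ + ν') (h : μ' univ = ν' univ) :
    W1 μ ν ≤ ∫⁻ x, ‖x‖ₑ ∂μ' + ∫⁻ x, ‖x‖ₑ ∂ν' := by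
  set m := μ' univ with hm
  have hmt : m ≠ ⊤ := measure_ne_top _ _
  have hdiag : Measurable fun x : E d => (x, x) := measurable_id.prodMk measurable_id
  set γ : Measure (E d × E d) := κ.map (fun x => (x, x)) + m⁻¹ • μ'.prod ν' with hγ
  have hed : Measurable fun z : E d × E d => edist z.1 z.2 := measurable_fst.edist measurable_snd
  -- If `m = 0` the factor `m⁻¹` is infinite, but the remainders vanish.
  have hcancel : ∀ a : Measure (E d), a univ = m → m⁻¹ • (m • a) = a := by
    intro a ha
    by_cases h0 : m = 0
    · rw [h0, Measure.measure_univ_eq_zero] at ha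
      simp [ha]
    · rw [smul_smul, ENNReal.inv_mul_cancel h0 hmt, one_smul]
  have g1 : γ.map Prod.fst = μ := by
    rw [hγ, Measure.map_add _ _ measurable_fst, Measure.map_map measurable_fst hdiag,
      Measure.map_smul, Measure.map_fst_prod, ← h, hcancel _ rfl, hμ]
    congr 1
    exact Measure.map_id
  have g2 : γ.map Prod.snd = ν := by
    rw [hγ, Measure.map_add _ _ measurable_snd, Measure.map_map measurable_snd hdiag,
      Measure.map_smul, Measure.map_snd_prod, ← hm, hcancel _ h.symm, hν]
    congr 1
    exact Measure.map_id
  refine (iInf₂_le γ ⟨g1, g2⟩).trans ?_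
  rw [hγ, lintegral_add_measure, lintegral_map hed hdiag, lintegral_smul_measure]
  simp only [edist_self, lintegral_zero, zero_add]
  have hint : ∫⁻ z, edist z.1 z.2 ∂μ'.prod ν' ≤
      m * (∫⁻ x, ‖x‖ₑ ∂μ' + ∫⁻ x, ‖x‖ₑ ∂ν') := by
    calc ∫⁻ z, edist z.1 z.2 ∂μ'.prod ν' ≤ ∫⁻ z, ‖z.1‖ₑ + ‖z.2‖ₑ ∂μ'.prod ν' := by
          refine lintegral_mono fun z => ?_
          rw [edist_eq_enorm_sub]
          exact enorm_sub_le
      _ = ∫⁻ x, ‖x‖ₑ ∂(μ'.prod ν').map Prod.fst + ∫⁻ x, ‖x‖ₑ ∂(μ'.prod ν').map Prod.snd := by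
          rw [lintegral_add_left measurable_fst.enorm, lintegral_map measurable_enorm measurable_fst,
            lintegral_map measurable_enorm measurable_snd]
      _ = _ := by
          rw [Measure.map_fst_prod, Measure.map_snd_prod, ← h, ← hm, lintegral_smul_measure,
            lintegral_smul_measure, mul_add]
          rfl
  rw [smul_eq_mul]
  refine (mul_le_mul_right hint _).trans ?_
  rw [← mul_assoc]
  exact mul_le_of_le_one_left' (ENNReal.inv_mul_le_one m)

/-- A Harris step with an invariant probability measure converges geometrically in `W₁`, if its
Lyapunov function dominates the norm. -/
theorem IsHarrisStep.exists_W1_le {P : Measure (E d) → Measure (E d)} {W : E d → ENNReal}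
    {l K D : NNReal} (h : IsHarrisStep P W l K) (hD : ∀ x, ‖x‖ₑ ≤ D * (1 + W x))
    (hD' : ∀ x, W x ≤ D * (1 + ‖x‖ₑ)) {π : Measure (E d)} [IsProbabilityMeasure π]
    (hπ : P π = π) (hπW : ∫⁻ x, W x ∂π ≠ ⊤) :
    ∃ ρ C : ℝ, 0 < ρ ∧ ρ < 1 ∧ 0 < C ∧ ∀ μ : Measure (E d), IsProbabilityMeasure μ →
      ∀ n : ℕ, W1 (P^[n] μ) π ≤ ENNReal.ofReal (C * ρ ^ n) * (1 + ∫⁻ q, ‖q‖ₑ ∂μ) := by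
  obtain ⟨β, ρ, hβ, hρ, hρ1, hit⟩ := h.exists_iterate_split
  lift ∫⁻ x, W x ∂π to NNReal using hπW with wπ hwπ
  -- `B` turns weighted mass into first moments; the last factor in `C` bounds the initial weighted
  -- mass, and the added one keeps `C` positive.
  set B : NNReal := D * (1 + β⁻¹) with hB
  set C : NNReal := B * (2 + β * (D + wπ)) + 1 with hC
  refine ⟨ρ, C, by exact_mod_cast hρ, by exact_mod_cast hρ1, by positivity, ?_⟩
  intro μ _ n
  obtain ⟨κ, μ', ν', _, _, _, eμ, eν, hm, hw⟩ := hit μ π (by simp) n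
  have hπn : P^[n] π = π := Function.iterate_fixed hπ n
  rw [hπn] at eν
  have hI : ∀ a : Measure (E d), ∫⁻ x, ‖x‖ₑ ∂a ≤ D * (a Set.univ + ∫⁻ x, W x ∂a) := by
    intro a
    calc _ ≤ ∫⁻ x, D * (1 + W x) ∂a := lintegral_mono hD
      _ = _ := by
        rw [lintegral_const_mul _ (h.measurable.const_add 1),
          lintegral_add_left measurable_const]
        simp
  have hβ' : (β : ENNReal) ≠ 0 := by exact_mod_cast hβ.ne'
  have h1 : ∫⁻ x, ‖x‖ₑ ∂μ' + ∫⁻ x, ‖x‖ₑ ∂ν' ≤ B * weightedMass W β μ' ν' := by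
    refine (add_le_add (hI μ') (hI ν')).trans ?_
    rw [weightedMass]
    set a := μ' Set.univ + ν' Set.univ with ha
    set w := ∫⁻ x, W x ∂μ' + ∫⁻ x, W x ∂ν' with hw
    have e1 : D * (μ' Set.univ + ∫⁻ x, W x ∂μ') + D * (ν' Set.univ + ∫⁻ x, W x ∂ν') =
        (D : ENNReal) * (a + w) := by rw [ha, hw]; ring
    have e2 : (B : ENNReal) = D * (1 + (β : ENNReal)⁻¹) := by
      rw [hB]; push_cast; rw [ENNReal.coe_inv hβ.ne']
    rw [e1, e2, mul_assoc]
    gcongr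
    calc a + w = 1 * a + (β : ENNReal)⁻¹ * (β * w) := by
          rw [← mul_assoc, ENNReal.inv_mul_cancel hβ' ENNReal.coe_ne_top, one_mul, one_mul]
      _ ≤ (1 + (β : ENNReal)⁻¹) * a + (1 + (β : ENNReal)⁻¹) * (β * w) := by
          gcongr
          · exact le_self_add
          · exact le_add_self
      _ = _ := by ring
  have h2 : weightedMass W β μ π ≤ (2 + β * (D + wπ) : NNReal) * (1 + ∫⁻ q, ‖q‖ₑ ∂μ) := by
    rw [weightedMass, ← hwπ]
    set e := ∫⁻ q, ‖q‖ₑ ∂μ with he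
    have h3 : ∫⁻ x, W x ∂μ ≤ D * (1 + e) := by
      calc _ ≤ ∫⁻ x, D * (1 + ‖x‖ₑ) ∂μ := lintegral_mono hD'
        _ = _ := by
          rw [lintegral_const_mul _ (measurable_enorm.const_add 1),
            lintegral_add_left measurable_const]
          simp [he]
    calc _ ≤ (1 + 1 : ENNReal) + β * (D * (1 + e) + wπ) := by gcongr <;> simp
      _ ≤ (1 + 1) * (1 + e) + β * (D * (1 + e) + wπ * (1 + e)) := by
        gcongr
        · exact le_mul_of_one_le_right' le_self_add
        · exact le_mul_of_one_le_right' le_self_add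
      _ = _ := by push_cast; ring
  calc W1 (P^[n] μ) π ≤ _ := W1_le_of_split eμ eν hm
    _ ≤ B * (ρ ^ n * ((2 + β * (D + wπ) : NNReal) * (1 + ∫⁻ q, ‖q‖ₑ ∂μ))) :=
      h1.trans (by gcongr; exact hw.trans (by gcongr))
    _ = (B * (2 + β * (D + wπ)) : NNReal) * (ρ : ENNReal) ^ n * (1 + ∫⁻ q, ‖q‖ₑ ∂μ) := by
      push_cast; ring
    _ ≤ _ := by
      gcongr
      rw [ENNReal.ofReal_mul (by positivity), ENNReal.ofReal_coe_nnreal,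
        ← NNReal.coe_pow, ENNReal.ofReal_coe_nnreal, ENNReal.coe_pow]
      gcongr
      exact_mod_cast (le_self_add : _ ≤ B * (2 + β * (D + wπ)) + 1)

end Wasserstein

/-! ### First moments of strictly log-concave densities. -/

section Density

open Set Filter Topology

variable {d : ℕ} {f g : E d → ℝ}

namespace IsStrictlyLogConcaveDensity

theorem eq_exp_neg_potential (hf : IsStrictlyLogConcaveDensity f) (x : E d) :
    f x = Real.exp (-potential f x) := by
  rw [potential, neg_neg, Real.exp_log (hf.pos x)]

theorem continuous (hf : IsStrictlyLogConcaveDensity f) : Continuous f := by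
  have : f = fun x => Real.exp (-potential f x) := funext hf.eq_exp_neg_potential
  rw [this]
  exact Real.continuous_exp.comp hf.contDiff.continuous.neg

theorem integrable (hf : IsStrictlyLogConcaveDensity f) : Integrable f := by
  by_contra h
  have := hf.integral_eq_one
  rw [integral_undef h] at this
  exact zero_ne_one this

theorem isProbabilityMeasure (hf : IsStrictlyLogConcaveDensity f) :
    IsProbabilityMeasure (densityMeasure f) := by
  refine ⟨?_⟩
  rw [densityMeasure, withDensity_apply _ MeasurableSet.univ, Measure.restrict_univ,
    ← ofReal_integral_eq_lintegral_ofReal hf.integrable (ae_of_all _ fun x => (hf.pos x).le),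
    hf.integral_eq_one, ENNReal.ofReal_one]

/-- A strictly log-concave density has a finite first moment. -/
theorem lintegral_norm_sub_lt_top (hf : IsStrictlyLogConcaveDensity f) (y : E d) :
    ∫⁻ x, ‖x - y‖ₑ ∂densityMeasure f ≠ ⊤ := by
  obtain ⟨m, M, hu⟩ := hf.exists_isUniformlyConvex
  obtain ⟨y₀, hy₀⟩ := hu.exists_gradient_eq_zero
  have hm := hu.pos
  -- The density decays like `exp (-2 b s²)`: one factor `exp (-b s²)` absorbs the linear growth,
  -- the other is integrable.
  set b := m / 4 with hb
  have hb0 : 0 < b := by positivity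
  have hgauss : Integrable fun x : E d => Real.exp (-b * ‖x - y₀‖ ^ 2) := by
    have h := (GaussianFourier.integrable_cexp_neg_mul_sq_norm_add (V := E d) (b := (b : ℂ))
      (by simpa using hb0) 0 0).norm
    have h2 : Integrable fun x : E d => Real.exp (-b * ‖x‖ ^ 2) := by
      refine h.congr (ae_of_all _ fun x => ?_)
      simp only [Complex.norm_exp]
      norm_cast
      simp
    exact h2.comp_sub_right y₀
  set C := Real.exp (-potential f y₀) * (‖y₀ - y‖ + (1 + b⁻¹)) with hC
  have hbound : ∀ x, ‖x - y‖ * f x ≤ C * Real.exp (-b * ‖x - y₀‖ ^ 2) := by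
    intro x
    set s := ‖x - y₀‖ with hs
    have hs0 : 0 ≤ s := norm_nonneg _
    have h1 : ‖x - y‖ ≤ s + ‖y₀ - y‖ := by
      have := norm_add_le (x - y₀) (y₀ - y); rwa [sub_add_sub_cancel] at this
    have h2 : f x ≤ Real.exp (-potential f y₀) *
        (Real.exp (-b * s ^ 2) * Real.exp (-b * s ^ 2)) := by
      rw [hf.eq_exp_neg_potential x, ← Real.exp_add, ← Real.exp_add]
      refine Real.exp_le_exp.2 ?_
      have := hu.le_sub_of_gradient_eq_zero hy₀ x
      rw [← hs] at this
      rw [hb]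
      linarith
    have h3 : Real.exp (-b * s ^ 2) ≤ 1 := Real.exp_le_one_iff.2 (by nlinarith [sq_nonneg s])
    have h4 : s * Real.exp (-b * s ^ 2) ≤ 1 + b⁻¹ := by
      have e := Real.add_one_le_exp (b * s ^ 2)
      have : s ≤ (1 + b⁻¹) * Real.exp (b * s ^ 2) := by
        calc s ≤ 1 + s ^ 2 := by nlinarith
          _ ≤ (1 + b⁻¹) * (b * s ^ 2 + 1) := by
            have e1 : (1 + b⁻¹) * (b * s ^ 2 + 1) = 1 + s ^ 2 + b * s ^ 2 + b⁻¹ := by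
              field_simp; ring
            rw [e1]
            have : 0 ≤ b * s ^ 2 := by positivity
            have : 0 < b⁻¹ := by positivity
            linarith
          _ ≤ _ := by gcongr
      have hp := Real.exp_pos (b * s ^ 2)
      rw [neg_mul, Real.exp_neg, ← div_eq_mul_inv, div_le_iff₀ hp]
      exact this
    have hx0 := Real.exp_pos (-potential f y₀)
    have hx1 := Real.exp_pos (-b * s ^ 2)
    calc ‖x - y‖ * f x ≤ (s + ‖y₀ - y‖) * (Real.exp (-potential f y₀) *
        (Real.exp (-b * s ^ 2) * Real.exp (-b * s ^ 2))) :=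
          mul_le_mul h1 h2 (hf.pos x).le (by positivity)
      _ = Real.exp (-potential f y₀) * (‖y₀ - y‖ * Real.exp (-b * s ^ 2) +
          s * Real.exp (-b * s ^ 2)) * Real.exp (-b * s ^ 2) := by ring
      _ ≤ Real.exp (-potential f y₀) * (‖y₀ - y‖ * 1 + (1 + b⁻¹)) * Real.exp (-b * s ^ 2) := by
          gcongr
      _ = _ := by rw [hC, mul_one]
  have hint : Integrable fun x => ‖x - y‖ * f x := by
    refine (hgauss.const_mul C).mono'
      ((continuous_id.sub continuous_const).norm.mul hf.continuous).aestronglyMeasurable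
      (ae_of_all _ fun x => ?_)
    rw [Real.norm_of_nonneg (mul_nonneg (norm_nonneg _) (hf.pos x).le)]
    exact hbound x
  have hn : Measurable fun x : E d => ‖x - y‖ₑ := (measurable_id.sub_const y).enorm
  rw [densityMeasure, lintegral_withDensity_eq_lintegral_mul _
    hf.continuous.measurable.ennreal_ofReal hn]
  have e : ∀ x, ((fun x => ENNReal.ofReal (f x)) * fun x : E d => ‖x - y‖ₑ) x =
      ENNReal.ofReal (‖x - y‖ * f x) := fun x => by
    rw [Pi.mul_apply, ENNReal.ofReal_mul (norm_nonneg _), ofReal_norm, mul_comm]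
  simp only [e]
  exact hint.lintegral_lt_top.ne

end IsStrictlyLogConcaveDensity

end Density

/-! ### Invariance of the target. -/

section Invariance

open Set Filter Topology

theorem MeasurePreserving.map_withDensity_of_comp_eq {X : Type*} [MeasurableSpace X]
    {μ : Measure X} {G : X → X} (hG : MeasurePreserving G μ μ) {h : X → ENNReal} (hh : Measurable h)
    (hinv : ∀ x, h (G x) = h x) : (μ.withDensity h).map G = μ.withDensity h := by
  ext s hs
  rw [Measure.map_apply hG.measurable hs, withDensity_apply _ (hG.measurable hs),
    withDensity_apply _ hs, ← hG.setLIntegral_comp_preimage hs hh]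
  simp only [hinv]

variable {d : ℕ} {m M : ℝ} {U V : E d → ℝ} {Φ : ℝ → E d × E d → E d × E d}

theorem IsHamiltonianFlow.energy_eq (hΦ : IsHamiltonianFlow U V Φ) (hU : IsUniformlyConvex m M U)
    (hV : IsUniformlyConvex m M V) (t : ℝ) (z : E d × E d) :
    U (Φ t z).1 + V (Φ t z).2 = U z.1 + V z.2 := by
  have hf := hΦ.isSeparableFlow hU hV
  have hd : ∀ s, HasDerivAt (fun s => U (Φ s z).1 + V (Φ s z).2) 0 s := fun s => by
    have h1 := (hU.hasGradientAt (Φ s z).1).hasFDerivAt.comp_hasDerivAt s (hf.hasDerivAt_fst z s)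
    have h2 := (hV.hasGradientAt (Φ s z).2).hasFDerivAt.comp_hasDerivAt s (hf.hasDerivAt_snd z s)
    have h3 := h1.add h2
    rw [InnerProductSpace.toDual_apply_apply, InnerProductSpace.toDual_apply_apply, inner_neg_right,
      real_inner_comm, add_neg_cancel] at h3
    exact h3
  have := is_const_of_deriv_eq_zero (fun s => (hd s).differentiableAt) (fun s => (hd s).deriv) t 0
  simpa [hf.zero] using this

/-- The target is invariant under every Hamiltonian move. -/
theorem hmcStep_densityMeasure {f g : E d → ℝ} (hf : IsStrictlyLogConcaveDensity f)
    (hg : IsStrictlyLogConcaveDensity g) (hU : IsUniformlyConvex m M (potential f))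
    (hV : IsUniformlyConvex m M (potential g))
    (hΦ : IsHamiltonianFlow (potential f) (potential g) Φ) (t : ℝ) :
    hmcStep Φ (densityMeasure g) t (densityMeasure f) = densityMeasure f := by
  have hflow := hΦ.isSeparableFlow hU hV
  have := hg.isProbabilityMeasure
  have hmf : Measurable fun x => ENNReal.ofReal (f x) := hf.continuous.measurable.ennreal_ofReal
  have hmg : Measurable fun x => ENNReal.ofReal (g x) := hg.continuous.measurable.ennreal_ofReal
  -- The joint density is a function of the energy, constant along the flow, and the flow preserves
  -- volume.
  have hprod : ((densityMeasure f).prod (densityMeasure g)).map (Φ t) =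
      (densityMeasure f).prod (densityMeasure g) := by
    rw [densityMeasure, densityMeasure, prod_withDensity hmf hmg, ← Measure.volume_eq_prod]
    refine MeasurePreserving.map_withDensity_of_comp_eq (hflow.measurePreserving t)
      ((hmf.comp measurable_fst).mul (hmg.comp measurable_snd)) fun z => ?_
    rw [← ENNReal.ofReal_mul (hf.pos _).le, ← ENNReal.ofReal_mul (hf.pos _).le,
      hf.eq_exp_neg_potential, hg.eq_exp_neg_potential, hf.eq_exp_neg_potential z.1,
      hg.eq_exp_neg_potential z.2, ← Real.exp_add, ← Real.exp_add, ← neg_add, ← neg_add,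
      hΦ.energy_eq hU hV]
  have e : hmcStep Φ (densityMeasure g) t (densityMeasure f) =
      (((densityMeasure f).prod (densityMeasure g)).map (Φ t)).map Prod.fst := by
    rw [Measure.map_map measurable_fst (hflow.continuous_space t).measurable]
    rfl
  rw [e, hprod, Measure.map_fst_prod, measure_univ, one_smul]

end Invariance

/-! ### Calculus of a single Hamiltonian move. -/

section Step

open Set Filter Topology

variable {d : ℕ} {Φ : ℝ → E d × E d → E d × E d} {G : Measure (E d)} [IsProbabilityMeasure G]
  {t : ℝ}

theorem hmcStep_univ (hΦ : Continuous (Φ t)) (μ : Measure (E d)) :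
    hmcStep Φ G t μ univ = μ univ := by
  rw [hmcStep, Measure.map_apply (by fun_prop) MeasurableSet.univ, preimage_univ,
    ← univ_prod_univ, Measure.prod_prod, measure_univ (μ := G), mul_one]

theorem isFiniteMeasure_hmcStep (hΦ : Continuous (Φ t)) (μ : Measure (E d)) [IsFiniteMeasure μ] :
    IsFiniteMeasure (hmcStep Φ G t μ) :=
  ⟨by rw [hmcStep_univ hΦ]; exact measure_lt_top _ _⟩

theorem hmcStep_add (hΦ : Continuous (Φ t)) (μ ν : Measure (E d)) [IsFiniteMeasure μ]
    [IsFiniteMeasure ν] : hmcStep Φ G t (μ + ν) = hmcStep Φ G t μ + hmcStep Φ G t ν := by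
  rw [hmcStep, Measure.add_prod, Measure.map_add _ _ (by fun_prop)]
  rfl

theorem hmcStep_smul (c : ENNReal) (μ : Measure (E d)) :
    hmcStep Φ G t (c • μ) = c • hmcStep Φ G t μ := by
  rw [hmcStep, Measure.prod_smul_left, Measure.map_smul]
  rfl

theorem hmcStep_mono (hΦ : Continuous (Φ t)) {μ ν : Measure (E d)} (h : μ ≤ ν) :
    hmcStep Φ G t μ ≤ hmcStep Φ G t ν :=
  Measure.map_mono (Measure.prod_mono h le_rfl) (by fun_prop)

theorem lintegral_hmcStep (hΦ : Continuous (Φ t)) (μ : Measure (E d))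
    {W : E d → ENNReal} (hW : Measurable W) :
    ∫⁻ x, W x ∂hmcStep Φ G t μ = ∫⁻ q, ∫⁻ p, W (Φ t (q, p)).1 ∂G ∂μ := by
  have hm : Measurable fun z => (Φ t z).1 := by fun_prop
  rw [hmcStep, lintegral_map hW hm,
    lintegral_prod (fun z => W (Φ t z).1) (hW.comp hm).aemeasurable]

theorem lintegral_hmcStep_le (hΦ : Continuous (Φ t)) (μ : Measure (E d))
    {W : E d → ENNReal} (hW : Measurable W) {l C : NNReal} {p₀ : E d}
    (h : ∀ q p, W (Φ t (q, p)).1 ≤ l * W q + C * ‖p - p₀‖ₑ) :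
    ∫⁻ x, W x ∂hmcStep Φ G t μ ≤
      l * ∫⁻ x, W x ∂μ + C * (∫⁻ p, ‖p - p₀‖ₑ ∂G) * μ univ := by
  rw [lintegral_hmcStep hΦ μ hW]
  have hn : Measurable fun p : E d => ‖p - p₀‖ₑ := (measurable_id.sub_const p₀).enorm
  calc _ ≤ ∫⁻ q, l * W q + C * ∫⁻ p, ‖p - p₀‖ₑ ∂G ∂μ := by
        refine lintegral_mono fun q => (lintegral_mono fun p => h q p).trans ?_
        rw [lintegral_add_left measurable_const, lintegral_const, measure_univ, mul_one,
          lintegral_const_mul _ hn]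
    _ = _ := by
        rw [lintegral_add_right _ measurable_const, lintegral_const_mul _ hW, lintegral_const]

end Step

/-! ### The drift of the Lyapunov function. -/

section Drift

open Set Filter Topology

variable {d : ℕ} {m M : ℝ} {U V : E d → ℝ} {Φ : ℝ → E d × E d → E d × E d}

/-- The Lyapunov function `√(U - U q₀)`. -/
def lyapunov (U : E d → ℝ) (q₀ q : E d) : ENNReal := ENNReal.ofReal √(U q - U q₀)

theorem measurable_lyapunov (hU : IsUniformlyConvex m M U) (q₀ : E d) :
    Measurable (lyapunov U q₀) :=
  ((hU.contDiff.continuous.sub continuous_const).sqrt).measurable.ennreal_ofReal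

/-- The root turns energy estimates, quadratic in the momentum, into linear ones, so that first
moments suffice. -/
theorem sqrt_le_of_le_mul_add {a b l C s : ℝ} (hl : 0 ≤ l) (hC : 0 ≤ C) (hs : 0 ≤ s)
    (h : a ≤ l ^ 2 * b + C ^ 2 * s ^ 2) (hb : 0 ≤ b) : √a ≤ l * √b + C * s := by
  refine Real.sqrt_le_iff.2 ⟨by positivity, h.trans ?_⟩
  have := Real.sq_sqrt hb
  have h2 : 0 ≤ l * √b * (C * s) := by positivity
  nlinarith

theorem lyapunov_le_of_le {q₀ q q' p p₀ : E d} {l C : NNReal}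
    (h : U q' - U q₀ ≤ l ^ 2 * (U q - U q₀) + C ^ 2 * ‖p - p₀‖ ^ 2) (h0 : 0 ≤ U q - U q₀) :
    lyapunov U q₀ q' ≤ l * lyapunov U q₀ q + C * ‖p - p₀‖ₑ := by
  rw [lyapunov, lyapunov, ← ofReal_norm, ← ENNReal.ofReal_coe_nnreal (p := l),
    ← ENNReal.ofReal_coe_nnreal (p := C), ← ENNReal.ofReal_mul l.coe_nonneg,
    ← ENNReal.ofReal_mul C.coe_nonneg, ← ENNReal.ofReal_add (by positivity) (by positivity)]
  exact ENNReal.ofReal_le_ofReal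
    (sqrt_le_of_le_mul_add l.coe_nonneg C.coe_nonneg (norm_nonneg _) h h0)

theorem lyapunov_le_norm (hU : IsUniformlyConvex m M U) {q₀ : E d} (hq₀ : gradient U q₀ = 0)
    (q : E d) : lyapunov U q₀ q ≤ ENNReal.ofReal √(M / 2) * ‖q - q₀‖ₑ := by
  rw [lyapunov, ← ofReal_norm, ← ENNReal.ofReal_mul (Real.sqrt_nonneg _)]
  refine ENNReal.ofReal_le_ofReal (Real.sqrt_le_iff.2 ⟨by positivity, ?_⟩)
  have := hU.pos'
  rw [mul_pow, Real.sq_sqrt (by positivity)]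
  exact hU.sub_le_of_gradient_eq_zero hq₀ q

theorem norm_le_sqrt (hU : IsUniformlyConvex m M U) {q₀ : E d} (hq₀ : gradient U q₀ = 0)
    (q : E d) : ‖q - q₀‖ ≤ √(2 / m) * √(U q - U q₀) := by
  have hm := hU.pos
  rw [← Real.sqrt_mul (by positivity)]
  refine Real.le_sqrt_of_sq_le ?_
  have := hU.le_sub_of_gradient_eq_zero hq₀ q
  rw [div_mul_eq_mul_div, le_div_iff₀ hm]
  linarith

namespace IsHamiltonianFlow

theorem flow_eq_self_of_gradient_eq_zero (hΦ : IsHamiltonianFlow U V Φ)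
    (hU : IsUniformlyConvex m M U) (hV : IsUniformlyConvex m M V) {q₀ p₀ : E d}
    (hq₀ : gradient U q₀ = 0) (hp₀ : gradient V p₀ = 0) (t : ℝ) : Φ t (q₀, p₀) = (q₀, p₀) := by
  refine ((hΦ.isSeparableFlow hU hV).eq_of_hasDerivAt (γ := fun _ => (q₀, p₀)) (fun s => ?_) t).symm
  simp only [hq₀, hp₀, neg_zero]
  exact hasDerivAt_const s _

theorem potential_sub_le (hΦ : IsHamiltonianFlow U V Φ) (hU : IsUniformlyConvex m M U)
    (hV : IsUniformlyConvex m M V) {q₀ p₀ : E d} (hp₀ : gradient V p₀ = 0) (t : ℝ) (q p : E d) :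
    U (Φ t (q, p)).1 - U q₀ ≤
      U q - U q₀ + M / 2 * ‖p - p₀‖ ^ 2 - m / 2 * ‖(Φ t (q, p)).2 - p₀‖ ^ 2 := by
  have h1 := hΦ.energy_eq hU hV t (q, p)
  have h2 := hV.sub_le_of_gradient_eq_zero hp₀ p
  have h3 := hV.le_sub_of_gradient_eq_zero hp₀ (Φ t (q, p)).2
  simp only at h1
  linarith

/-- A move of any duration increases the Lyapunov function at most by a multiple of the size of
the momentum. -/
theorem exists_lyapunov_le (hΦ : IsHamiltonianFlow U V Φ) (hU : IsUniformlyConvex m M U)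
    (hV : IsUniformlyConvex m M V) {q₀ p₀ : E d} (hq₀ : gradient U q₀ = 0)
    (hp₀ : gradient V p₀ = 0) : ∃ C : NNReal, ∀ t q p,
      lyapunov U q₀ (Φ t (q, p)).1 ≤ (1 : NNReal) * lyapunov U q₀ q + C * ‖p - p₀‖ₑ := by
  have hm := hU.pos
  have hM := hU.pos'
  refine ⟨NNReal.mk √(M / 2) (Real.sqrt_nonneg _), fun t q p => lyapunov_le_of_le ?_ ?_⟩
  · have := hΦ.potential_sub_le hU hV (q₀ := q₀) hp₀ t q p
    have h2 : 0 ≤ m / 2 * ‖(Φ t (q, p)).2 - p₀‖ ^ 2 := by positivity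
    rw [NNReal.coe_mk, Real.sq_sqrt (by positivity), NNReal.coe_one]
    linarith
  · exact (by positivity : 0 ≤ m / 2 * ‖q - q₀‖ ^ 2).trans (hU.le_sub_of_gradient_eq_zero hq₀ q)

/-- The forward move contracts the Lyapunov function, up to a multiple of the size of the
momentum. -/
theorem exists_lyapunov_contraction (hΦ : IsHamiltonianFlow U V Φ) (hU : IsUniformlyConvex m M U)
    (hV : IsUniformlyConvex m M V) {q₀ p₀ : E d} (hq₀ : gradient U q₀ = 0)
    (hp₀ : gradient V p₀ = 0) {a T : ℝ} (ha : 0 < a) (hT : 0 < T) (haT : a * T < Real.pi)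
    (hpair : ∀ p q, ‖hess V p ∘L hess U q‖ ≤ a ^ 2) :
    ∃ l C : NNReal, l < 1 ∧ ∀ q p,
      lyapunov U q₀ (Φ T (q, p)).1 ≤ l * lyapunov U q₀ q + C * ‖p - p₀‖ₑ := by
  have hm := hU.pos
  have hM := hU.pos'
  obtain ⟨c, hc, hmom⟩ := hΦ.exists_le_norm_momentum_sub hU hV ha haT hpair hT le_rfl
  set L := Real.exp (M * T) with hLd
  have hL : 0 < L := Real.exp_pos _
  -- A final momentum of size about `c * ‖q - q₀‖` takes this fraction of the potential energy away;
  -- the cut-off at zero makes the square root meaningful.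
  set κ := max (1 - m * c ^ 2 / (2 * M)) 0 with hκ
  have hκ0 : 0 ≤ κ := le_max_right _ _
  have hκ1 : κ < 1 := max_lt (by have : 0 < m * c ^ 2 / (2 * M) := by positivity
                                 linarith) one_pos
  refine ⟨NNReal.mk √κ (Real.sqrt_nonneg _),
    NNReal.mk √(M / 2 + m / 2 * L ^ 2) (Real.sqrt_nonneg _), ?_,
    fun q p => lyapunov_le_of_le ?_ ?_⟩
  · rw [← NNReal.coe_lt_coe]
    exact (Real.sqrt_lt' one_pos).2 (by simpa using hκ1)
  · rw [NNReal.coe_mk, NNReal.coe_mk, Real.sq_sqrt hκ0, Real.sq_sqrt (by positivity)]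
    have h1 := hΦ.potential_sub_le hU hV (q₀ := q₀) hp₀ T q p
    -- The motion from `(q, p₀)` is compared with the equilibrium `(q₀, p₀)`; replacing `p₀` by `p`
    -- costs at most `L * ‖p - p₀‖`.
    have h2 := hmom T ⟨le_rfl, le_rfl⟩ p₀ q q₀
    rw [hΦ.flow_eq_self_of_gradient_eq_zero hU hV hq₀ hp₀] at h2
    have h3 := (norm_snd_le _).trans
      (hΦ.norm_sub_le hU hV (T := T) (s := T) ⟨hT.le, le_rfl⟩ (q, p₀) (q, p))
    rw [dist_prodMk_left, dist_comm, dist_eq_norm, ← hLd] at h3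
    have h4 : c * ‖q - q₀‖ ≤ ‖(Φ T (q, p)).2 - p₀‖ + L * ‖p - p₀‖ := by
      have h5 := norm_add_le ((Φ T (q, p₀)).2 - (Φ T (q, p)).2) ((Φ T (q, p)).2 - p₀)
      rw [sub_add_sub_cancel] at h5
      have h6 : ‖(Φ T (q, p₀)).2 - (Φ T (q, p)).2‖ ≤ L * ‖p - p₀‖ := h3
      simp only at h2
      linarith
    set x := ‖(Φ T (q, p)).2 - p₀‖
    set y := ‖p - p₀‖
    set w := ‖q - q₀‖
    have hw : 0 ≤ w := norm_nonneg _
    have h7 : c ^ 2 * w ^ 2 ≤ 2 * x ^ 2 + 2 * (L ^ 2 * y ^ 2) := by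
      have : (c * w) ^ 2 ≤ (x + L * y) ^ 2 := by gcongr
      nlinarith [sq_nonneg (x - L * y)]
    have h8 := hU.sub_le_of_gradient_eq_zero hq₀ q
    have h9 : m * c ^ 2 / (2 * M) * (U q - U q₀) ≤ m / 4 * (c ^ 2 * w ^ 2) := by
      calc _ ≤ m * c ^ 2 / (2 * M) * (M / 2 * w ^ 2) := by gcongr
        _ = _ := by field_simp; ring
    have h10 : (1 - m * c ^ 2 / (2 * M)) * (U q - U q₀) ≤ κ * (U q - U q₀) := by
      have : 0 ≤ U q - U q₀ := (by positivity : 0 ≤ m / 2 * ‖q - q₀‖ ^ 2).trans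
        (hU.le_sub_of_gradient_eq_zero hq₀ q)
      gcongr
      exact le_max_left _ _
    nlinarith
  · exact (by positivity : 0 ≤ m / 2 * ‖q - q₀‖ ^ 2).trans (hU.le_sub_of_gradient_eq_zero hq₀ q)

end IsHamiltonianFlow

end Drift

/-! ### Minorization on bounded sets. -/

section Minorization

open Set Filter Topology

variable {d : ℕ} {m M : ℝ} {U V : E d → ℝ} {Φ : ℝ → E d × E d → E d × E d}

/-- Lebesgue measure is a multiple of the `d`-dimensional Hausdorff measure, which scales this way.
-/
theorem volume_image_le_of_lipschitz {L : NNReal} {F : E d → E d} (hF : LipschitzWith L F)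
    (s : Set (E d)) : volume (F '' s) ≤ (L : ENNReal) ^ d * volume s := by
  rw [Measure.isAddLeftInvariant_eq_smul (volume : Measure (E d))
    (Measure.hausdorffMeasure d)]
  have := hF.hausdorffMeasure_image_le (d := d) (Nat.cast_nonneg d) s
  rw [ENNReal.rpow_natCast] at this
  simp only [Measure.smul_apply, ENNReal.smul_def, smul_eq_mul]
  refine (mul_le_mul_right this _).trans (le_of_eq ?_)
  ring

/-- The image of a density under a Lipschitz surjection is bounded below on any set whose preimage
carries a lower bound of the density. -/
theorem le_densityMeasure_preimage {g : E d → ℝ} (hg : Measurable g) {L : NNReal} {F : E d → E d}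
    (hF : LipschitzWith L F) (hsurj : Function.Surjective F) {c : ℝ} {A : Set (E d)}
    (hA : MeasurableSet A) (hc : ∀ p, F p ∈ A → c ≤ g p) :
    ENNReal.ofReal c * volume A ≤ (L : ENNReal) ^ d * densityMeasure g (F ⁻¹' A) := by
  have hm : MeasurableSet (F ⁻¹' A) := hF.continuous.measurable hA
  have h1 : ENNReal.ofReal c * volume (F ⁻¹' A) ≤ densityMeasure g (F ⁻¹' A) := by
    rw [densityMeasure, withDensity_apply _ hm, ← setLIntegral_const]
    exact setLIntegral_mono hg.ennreal_ofReal fun p hp => ENNReal.ofReal_le_ofReal (hc p hp)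
  have h2 := volume_image_le_of_lipschitz hF (F ⁻¹' A)
  rw [image_preimage_eq A hsurj] at h2
  calc _ ≤ ENNReal.ofReal c * ((L : ENNReal) ^ d * volume (F ⁻¹' A)) := by gcongr
    _ = (L : ENNReal) ^ d * (ENNReal.ofReal c * volume (F ⁻¹' A)) := by ring
    _ ≤ _ := by gcongr

/-- The positions reached by a move from a bounded set have a common component. -/
theorem IsHamiltonianFlow.exists_minorization (hΦ : IsHamiltonianFlow U V Φ)
    (hU : IsUniformlyConvex m M U) (hV : IsUniformlyConvex m M V) {a T : ℝ} (ha : 0 < a)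
    (hT : 0 < T) (haT : a * T < Real.pi) (hpair : ∀ p q, ‖hess V p ∘L hess U q‖ ≤ a ^ 2)
    {g : E d → ℝ} (hg : IsStrictlyLogConcaveDensity g) (q₀ : E d) (r : ℝ) :
    ∃ α : NNReal, 0 < α ∧ α ≤ 1 ∧ ∃ ν₀ : Measure (E d), IsProbabilityMeasure ν₀ ∧
      ∀ (μ : Measure (E d)) [IsFiniteMeasure μ] (S : Set (E d)), MeasurableSet S →
        (∀ q ∈ S, ‖q - q₀‖ ≤ r) → (α * μ S) • ν₀ ≤ hmcStep Φ (densityMeasure g) T μ := by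
  have hflow := hΦ.isSeparableFlow hU hV
  have hΦT : Measurable fun z => (Φ T z).1 :=
    measurable_fst.comp (hflow.continuous_space T).measurable
  have := hg.isProbabilityMeasure
  obtain ⟨c, hc, hexp⟩ := hΦ.exists_le_norm_position_sub hU hV ha haT hpair hT le_rfl
  set L : NNReal := NNReal.mk (Real.exp (M * T)) (Real.exp_pos _).le with hLd
  have hL0 : 0 < L := Real.exp_pos _
  have hLip : ∀ z w, ‖(Φ T z).1 - (Φ T w).1‖ ≤ L * dist z w := fun z w =>
    (norm_fst_le (Φ T z - Φ T w)).trans (hΦ.norm_sub_le hU hV (T := T) (s := T) ⟨hT.le, le_rfl⟩ z w)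
  have hLip' : ∀ q, LipschitzWith L fun p => (Φ T (q, p)).1 := fun q =>
    LipschitzWith.of_dist_le_mul fun p p' => by
      rw [dist_eq_norm, ← dist_prodMk_left q p p']; exact hLip _ _
  set N := ‖(Φ T (q₀, 0)).1‖ with hN
  -- By the expansion bound, every momentum leading from within `r` of `q₀` into the unit ball has
  -- at most this norm.
  set r' := (1 + N + L * r) / c with hr'
  obtain ⟨b, hb0, hb⟩ : ∃ b : ℝ, 0 < b ∧ ∀ p : E d, ‖p‖ ≤ r' → b ≤ g p := by
    -- `r` is arbitrary, so `r'` may be negative.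
    rcases (Metric.closedBall (0 : E d) r').eq_empty_or_nonempty with h | h
    · refine ⟨1, one_pos, fun p hp => ?_⟩
      have : p ∈ Metric.closedBall (0 : E d) r' := by simpa using hp
      rw [h] at this
      exact this.elim
    · obtain ⟨p₁, -, h₁⟩ := (isCompact_closedBall (0 : E d) r').exists_isMinOn h
        hg.continuous.continuousOn
      exact ⟨g p₁, hg.pos p₁, fun p hp => h₁ (by simpa using hp)⟩
  set B := Metric.closedBall (0 : E d) 1 with hB
  have hBv : volume B ≠ 0 := (Metric.measure_closedBall_pos volume _ one_pos).ne'
  have hBt : volume B ≠ ⊤ := measure_closedBall_lt_top.ne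
  have hBm : MeasurableSet B := Metric.isClosed_closedBall.measurableSet
  have key : ∀ q, ‖q - q₀‖ ≤ r → ∀ A, MeasurableSet A →
      ENNReal.ofReal b * volume (A ∩ B) ≤
        (L : ENNReal) ^ d * densityMeasure g ((fun p => (Φ T (q, p)).1) ⁻¹' A) := by
    intro q hq A hA
    refine (le_densityMeasure_preimage (c := b) hg.continuous.measurable (hLip' q)
      (hΦ.surjective_position hU hV ha hT haT hpair q) (hA.inter hBm) fun p hp => hb p ?_).trans ?_
    · have h1 : ‖(Φ T (q, p)).1‖ ≤ 1 := by simpa [hB] using hp.2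
      have h2 := hexp T ⟨le_rfl, le_rfl⟩ q p 0
      have h3 := hLip (q, (0 : E d)) (q₀, 0)
      rw [dist_prodMk_right, dist_eq_norm] at h3
      have h4 : (L : ℝ) * ‖q - q₀‖ ≤ L * r := by gcongr
      have h5 : ‖(Φ T (q, 0)).1‖ ≤ N + L * r := by
        have := norm_add_le ((Φ T (q, (0 : E d))).1 - (Φ T (q₀, 0)).1) (Φ T (q₀, 0)).1
        rw [sub_add_cancel] at this
        linarith
      have h6 := _root_.norm_sub_le (Φ T (q, p)).1 (Φ T (q, 0)).1
      rw [sub_zero] at h2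
      rw [hr', le_div_iff₀ hc]
      linarith
    · gcongr
      exact inter_subset_left
  have hLd0 : (L : ENNReal) ^ d ≠ 0 := pow_ne_zero _ (by exact_mod_cast hL0.ne')
  have hLdt : (L : ENNReal) ^ d ≠ ⊤ := ENNReal.pow_ne_top ENNReal.coe_ne_top
  set α₀ : ENNReal := ((L : ENNReal) ^ d)⁻¹ * ENNReal.ofReal b * volume B with hα₀
  have hα₀0 : α₀ ≠ 0 := mul_ne_zero (mul_ne_zero (ENNReal.inv_ne_zero.2 hLdt) (by simpa using hb0)) hBv
  have hα₁t : min α₀ 1 ≠ ⊤ := ne_top_of_le_ne_top ENNReal.one_ne_top (min_le_right _ _)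
  have hα₁0 : min α₀ 1 ≠ 0 := (lt_min (pos_iff_ne_zero.2 hα₀0) one_pos).ne'
  refine ⟨(min α₀ 1).toNNReal, pos_iff_ne_zero.2 (by simp [ENNReal.toNNReal_eq_zero_iff, hα₀0, hα₁t]),
    ?_, (volume B)⁻¹ • volume.restrict B, ?_, ?_⟩
  · rw [← ENNReal.coe_le_coe, ENNReal.coe_toNNReal hα₁t]
    exact min_le_right _ _
  · refine ⟨?_⟩
    rw [Measure.smul_apply, Measure.restrict_apply_univ, smul_eq_mul,
      ENNReal.inv_mul_cancel hBv hBt]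
  · intro μ _ S hS hSr
    refine Measure.le_iff.2 fun A hA => ?_
    rw [ENNReal.coe_toNNReal hα₁t, hmcStep, Measure.map_apply hΦT hA,
      Measure.prod_apply (hΦT hA), Measure.smul_apply, Measure.smul_apply,
      Measure.restrict_apply hA, smul_eq_mul, smul_eq_mul]
    have h1 : ∀ q ∈ S, ((L : ENNReal) ^ d)⁻¹ * (ENNReal.ofReal b * volume (A ∩ B)) ≤
        densityMeasure g (Prod.mk q ⁻¹' ((fun z => (Φ T z).1) ⁻¹' A)) := fun q hq => by
      refine (mul_le_mul_right (key q (hSr q hq) A hA) _).trans (le_of_eq ?_)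
      rw [← mul_assoc, ENNReal.inv_mul_cancel hLd0 hLdt, one_mul]
      rfl
    calc min α₀ 1 * μ S * ((volume B)⁻¹ * volume (A ∩ B))
        ≤ α₀ * μ S * ((volume B)⁻¹ * volume (A ∩ B)) := by gcongr; exact min_le_left _ _
      _ = (volume B * (volume B)⁻¹) *
          (((L : ENNReal) ^ d)⁻¹ * (ENNReal.ofReal b * volume (A ∩ B)) * μ S) := by
        rw [hα₀]; ring
      _ = ∫⁻ _ in S, ((L : ENNReal) ^ d)⁻¹ * (ENNReal.ofReal b * volume (A ∩ B)) ∂μ := by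
        rw [ENNReal.mul_inv_cancel hBv hBt, one_mul, setLIntegral_const]
      _ ≤ ∫⁻ q in S, densityMeasure g (Prod.mk q ⁻¹' ((fun z => (Φ T z).1) ⁻¹' A)) ∂μ :=
        setLIntegral_mono (measurable_measure_prodMk_left (hΦT hA)) h1
      _ ≤ _ := setLIntegral_le_lintegral _ _

end Minorization

/-! ### Assembly for AD-HMC. -/

section Main

open Set

variable {d : ℕ} {m M : ℝ} {f g : E d → ℝ} {Φ : ℝ → E d × E d → E d × E d}

/-- AD-HMC satisfies the hypotheses of Harris' theorem. -/
theorem exists_isHarrisStep_adhmcStep (hU : IsUniformlyConvex m M (potential f))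
    (hV : IsUniformlyConvex m M (potential g)) (hg : IsStrictlyLogConcaveDensity g)
    (hΦ : IsHamiltonianFlow (potential f) (potential g) Φ) {q₀ p₀ : E d}
    (hq₀ : gradient (potential f) q₀ = 0) (hp₀ : gradient (potential g) p₀ = 0)
    {a T : ℝ} (ha : 0 < a) (hT : 0 < T) (haT : a * T < Real.pi)
    (hpair : ∀ p q, ‖hess (potential g) p ∘L hess (potential f) q‖ ≤ a ^ 2) :
    ∃ l K, IsHarrisStep (adhmcStep Φ (densityMeasure g) T) (lyapunov (potential f) q₀) l K := by
  have hflow := hΦ.isSeparableFlow hU hV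
  have hc : ∀ t, Continuous (Φ t) := hflow.continuous_space
  have := hg.isProbabilityMeasure
  have hW := measurable_lyapunov hU q₀
  obtain ⟨l, C, hl, hfor⟩ := hΦ.exists_lyapunov_contraction hU hV hq₀ hp₀ ha hT haT hpair
  obtain ⟨C', hback⟩ := hΦ.exists_lyapunov_le hU hV hq₀ hp₀
  have hG := hg.lintegral_norm_sub_lt_top p₀
  set I := ∫⁻ p, ‖p - p₀‖ₑ ∂densityMeasure g with hI
  refine ⟨l, (C + C') * I.toNNReal, hW, hl, ?_, ?_, ?_, ?_⟩
  · intro μ ν _ _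
    have := isFiniteMeasure_hmcStep (G := densityMeasure g) (hc T) μ
    have := isFiniteMeasure_hmcStep (G := densityMeasure g) (hc T) ν
    rw [adhmcStep, hmcStep_add (hc _), hmcStep_add (hc _)]
    rfl
  · intro μ _
    rw [adhmcStep, hmcStep_univ (hc _), hmcStep_univ (hc _)]
  · intro μ _
    rw [adhmcStep]
    refine (lintegral_hmcStep_le (hc _) _ hW (hback (-T))).trans ?_
    rw [hmcStep_univ (hc _), ENNReal.coe_one, one_mul]
    refine (add_le_add_left (lintegral_hmcStep_le (hc _) _ hW hfor) _).trans (le_of_eq ?_)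
    push_cast
    rw [ENNReal.coe_toNNReal hG]
    ring
  · intro R
    obtain ⟨α, hα, hα1, ν₀, hν₀, hmin⟩ := hΦ.exists_minorization hU hV ha hT haT hpair hg q₀
      (√(2 / m) * R)
    refine ⟨α, hα, hα1, hmcStep Φ (densityMeasure g) (-T) ν₀,
      ⟨by rw [hmcStep_univ (hc _), measure_univ]⟩, fun μ _ => ?_⟩
    -- The forward move provides the common component; the backward move, being linear and monotone,
    -- carries it along.
    rw [← hmcStep_smul, adhmcStep]
    refine hmcStep_mono (hc _) (hmin μ _ (measurableSet_le hW measurable_const) fun q hq => ?_)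
    refine (norm_le_sqrt hU hq₀ q).trans ?_
    gcongr
    have h1 : lyapunov (potential f) q₀ q ≤ R := hq
    rwa [lyapunov, ← ENNReal.ofReal_coe_nnreal, ENNReal.ofReal_le_ofReal_iff R.coe_nonneg] at h1

theorem enorm_le_lyapunov {U : E d → ℝ} (hU : IsUniformlyConvex m M U) {q₀ : E d}
    (hq₀ : gradient U q₀ = 0) : ∃ D : NNReal, (∀ x, ‖x‖ₑ ≤ D * (1 + lyapunov U q₀ x)) ∧
      ∀ x, lyapunov U q₀ x ≤ D * (1 + ‖x‖ₑ) := by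
  have h1 : ∀ x, ‖x - q₀‖ₑ ≤ ENNReal.ofReal √(2 / m) * lyapunov U q₀ x := fun x => by
    rw [lyapunov, ← ofReal_norm, ← ENNReal.ofReal_mul (Real.sqrt_nonneg _)]
    exact ENNReal.ofReal_le_ofReal (norm_le_sqrt hU hq₀ x)
  have h2 := lyapunov_le_norm hU hq₀
  set s : NNReal := (√(2 / m)).toNNReal
  set s' : NNReal := (√(M / 2)).toNNReal
  have es : ENNReal.ofReal √(2 / m) = s := rfl
  have es' : ENNReal.ofReal √(M / 2) = s' := rfl
  have eq : ‖q₀‖ₑ = (‖q₀‖₊ : ENNReal) := rfl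
  refine ⟨‖q₀‖₊ + s + s' + s' * ‖q₀‖₊, fun x => ?_, fun x => ?_⟩
  · have h3 : ‖x‖ₑ ≤ ‖x - q₀‖ₑ + ‖q₀‖ₑ := by
      have := enorm_add_le (x - q₀) q₀; rwa [sub_add_cancel] at this
    calc ‖x‖ₑ ≤ s * lyapunov U q₀ x + ‖q₀‖₊ := h3.trans (add_le_add (h1 x) le_rfl)
      _ ≤ s * lyapunov U q₀ x + ‖q₀‖₊ + (s + s' + s' * ‖q₀‖₊ +
          (‖q₀‖₊ + s' + s' * ‖q₀‖₊) * lyapunov U q₀ x) := le_self_add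
      _ = _ := by push_cast; ring
  · have h3 : ‖x - q₀‖ₑ ≤ ‖x‖ₑ + ‖q₀‖₊ := enorm_sub_le
    calc lyapunov U q₀ x ≤ s' * (‖x‖ₑ + ‖q₀‖₊) := (h2 x).trans (by rw [es']; gcongr)
      _ ≤ s' * (‖x‖ₑ + ‖q₀‖₊) + (‖q₀‖₊ + s + s' +
          (‖q₀‖₊ + s + s' * ‖q₀‖₊) * ‖x‖ₑ) := le_self_add
      _ = _ := by push_cast; ring

end Main

end ADHMC

end

theorem mainTheorem4 {d : ℕ} (f g : ADHMC.E d → ℝ)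
    (hf : ADHMC.IsStrictlyLogConcaveDensity f) (hg : ADHMC.IsStrictlyLogConcaveDensity g)
    (Φ : ℝ → ADHMC.E d × ADHMC.E d → ADHMC.E d × ADHMC.E d)
    (hΦ : ADHMC.IsHamiltonianFlow (ADHMC.potential f) (ADHMC.potential g) Φ)
    (T : ℝ) (hT0 : 0 < T)
    (hT : ENNReal.ofReal T <
      ENNReal.ofReal Real.pi / ADHMC.normA (ADHMC.potential f) (ADHMC.potential g) Φ T) :
    ∃ ρ C : ℝ, 0 < ρ ∧ ρ < 1 ∧ 0 < C ∧
      ∀ μ : MeasureTheory.Measure (ADHMC.E d), MeasureTheory.IsProbabilityMeasure μ →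
        ∫⁻ q, ‖q‖ₑ ∂μ < ⊤ →
        ∀ n : ℕ,
          ADHMC.W1 ((ADHMC.adhmcStep Φ (ADHMC.densityMeasure g) T)^[n] μ)
              (ADHMC.densityMeasure f) ≤
            ENNReal.ofReal (C * ρ ^ n) * (1 + ∫⁻ q, ‖q‖ₑ ∂μ) := by
  obtain ⟨m₁, M₁, hU₁⟩ := hf.exists_isUniformlyConvex
  obtain ⟨m₂, M₂, hV₂⟩ := hg.exists_isUniformlyConvex
  -- Both potentials are given the same convexity constants, as the flow lemmas require.
  have hm : 0 < min m₁ m₂ := lt_min hU₁.pos hV₂.pos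
  have hU := hU₁.mono hm (min_le_left _ _) (le_max_left M₁ M₂)
  have hV := hV₂.mono hm (min_le_right _ _) (le_max_right M₁ M₂)
  obtain ⟨a, ha, haT, hA⟩ := ADHMC.exists_forall_norm_opA_le hT0 hT
  have hpair := ADHMC.norm_hess_comp_hess_le hΦ hU hV hT0 hA
  obtain ⟨q₀, hq₀⟩ := hU.exists_gradient_eq_zero
  obtain ⟨p₀, hp₀⟩ := hV.exists_gradient_eq_zero
  obtain ⟨l, K, hstep⟩ :=
    ADHMC.exists_isHarrisStep_adhmcStep hU hV hg hΦ hq₀ hp₀ ha hT0 haT hpair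
  obtain ⟨D, hD, hD'⟩ := ADHMC.enorm_le_lyapunov hU hq₀
  have := hf.isProbabilityMeasure
  have hinv : ADHMC.adhmcStep Φ (ADHMC.densityMeasure g) T (ADHMC.densityMeasure f) =
      ADHMC.densityMeasure f := by
    rw [ADHMC.adhmcStep, ADHMC.hmcStep_densityMeasure hf hg hU hV hΦ,
      ADHMC.hmcStep_densityMeasure hf hg hU hV hΦ]
  have hfin : ∫⁻ x, ADHMC.lyapunov (ADHMC.potential f) q₀ x ∂ADHMC.densityMeasure f ≠ ⊤ := by
    refine ne_top_of_le_ne_top ?_ (MeasureTheory.lintegral_mono (ADHMC.lyapunov_le_norm hU hq₀))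
    rw [MeasureTheory.lintegral_const_mul' _ _ ENNReal.ofReal_ne_top]
    exact ENNReal.mul_ne_top ENNReal.ofReal_ne_top (hf.lintegral_norm_sub_lt_top q₀)
  obtain ⟨ρ, C, hρ, hρ1, hC, h⟩ := hstep.exists_W1_le hD hD' hinv hfin
  exact ⟨ρ, C, hρ, hρ1, hC, fun μ hμ _ n => h μ hμ n⟩
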